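/- Let $X$ be a locally compact, paracompact Hausdorff space and let $G$ be an abelian group. Call a subset of $X$ bounded if its closure is compact. For $n\ge 0$ let $K_n(X,G)$ be the abelian group of all functions $f$ that assign an element $f(E_0,\dots,E_n)\in G$ to every $(n+1)$-tuple of bounded subsets of $X$ and satisfy: (1) $f$ is additive in each argument with respect to disjoint unions, i.e. if $E_i=E_i'\cup E_i''$ with $E_i'\cap E_i''=\varnothing$, then $f(\dots,E_i,\dots)=f(\dots,E_i',\dots)+f(\dots,E_i'',\dots)$; (2) $f$ is multiplied by the sign of the permutation when its arguments are permuted, and $f$ vanishes when two arguments are equal; (3) $f(E_0,\dots,E_n)=0$ whenever $\overline{E}_0\cap\dots\cap\overline{E}_n=\varnothing$. For $n\ge 1$ let $\Delta:K_n(X,G)\to K_{n-1}(X,G)$ be given by $\Delta f(E_0,\dots,E_{n-1})=f(U,E_0,\dots,E_{n-1})$, where $U$ is any open bounded set containing $\overline{E}_0\cup\dots\cup\overline{E}_{n-1}$ (the value does not depend on $U$). The Kolmogoroff homology group $H^K_n(X,G)$ is the $n$-th homology group of the chain complex $(K_*(X,G),\Delta)$. Let $\dot X=X\cup\{*\}$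 be the one-point (Alexandroff) compactification of $X$ (with $*$ isolated if $X$ is compact), and let $\check H^n(\dot X,*)$ be the $n$-th Čech cohomology group of the pair $(\dot X,\{*\})$ with integer coefficients, that is, the direct limit, over all open covers of $\dot X$ directed by refinement, of the $n$-th relative cohomology groups of the nerve of the cover modulo the nerve of its trace on $\{*\}$. Then for every integer $n\ge 0$ there is a short exact sequence of abelian groups $$0\longrightarrow \operatorname{Ext}\bigl(\check H^{n+1}(\dot X,*),G\bigr)\longrightarrow H^K_n(X,G)\longrightarrow \operatorname{Hom}\bigl(\check H^n(\dot X,*),G\bigr)\longrightarrow 0 .$$ -/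

import Mathlib

universe u v

open CategoryTheory

/-! ## Kolmogoroff homology -/

namespace Kolmogoroff

/-- The bounded subsets of `X`: those with compact closure. -/
abbrev Bounded (X : Type u) [TopologicalSpace X] : Type u :=
  {E : Set X // IsCompact (closure E)}

section

variable {X : Type u} [TopologicalSpace X]

/-- The union of two bounded sets, as a bounded set. -/
def Bounded.union (A B : Bounded X) : Bounded X :=
  ⟨A.1 ∪ B.1, by rw [closure_union]; exact A.2.union B.2⟩

/-- A subset of a bounded set, as a bounded set. -/
def Bounded.sub (A : Bounded X) (S : Set X) (h : S ⊆ A.1) : Bounded X :=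
  ⟨S, A.2.of_isClosed_subset isClosed_closure (closure_mono h)⟩

end

variable (X : Type u) [TopologicalSpace X] (G : Type v) [AddCommGroup G]

/-- `IsChain X G n f`: the function `f` of `n + 1` bounded sets is an `n`-dimensional
Kolmogoroff chain. -/
structure IsChain (n : ℕ) (f : (Fin (n + 1) → Bounded X) → G) : Prop where
  additive : ∀ (E : Fin (n + 1) → Bounded X) (i : Fin (n + 1)) (A B : Bounded X),
    Disjoint A.1 B.1 →
      f (Function.update E i (A.union B)) =
        f (Function.update E i A) + f (Function.update E i B)
  perm : ∀ (E : Fin (n + 1) → Bounded X) (σ : Equiv.Perm (Fin (n + 1))),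
    f (E ∘ σ) = (Equiv.Perm.sign σ : ℤ) • f E
  eq_zero_of_eq : ∀ (E : Fin (n + 1) → Bounded X) (i j : Fin (n + 1)),
    i ≠ j → E i = E j → f E = 0
  eq_zero_of_closures : ∀ E : Fin (n + 1) → Bounded X,
    ⋂ i, closure (E i).1 = ∅ → f E = 0

/-- The group `K_n(X, G)` of `n`-dimensional Kolmogoroff chains. -/
def chains (n : ℕ) : AddSubgroup ((Fin (n + 1) → Bounded X) → G) where
  carrier := {f | IsChain X G n f}
  zero_mem' := ⟨by simp, by simp, by simp, by simp⟩
  add_mem' {f g} hf hg :=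
    { additive := fun E i A B h => by
        simp only [Pi.add_apply, hf.additive E i A B h, hg.additive E i A B h]; abel
      perm := fun E σ => by simp only [Pi.add_apply, hf.perm E σ, hg.perm E σ, smul_add]
      eq_zero_of_eq := fun E i j h h' => by
        simp [hf.eq_zero_of_eq E i j h h', hg.eq_zero_of_eq E i j h h']
      eq_zero_of_closures := fun E h => by
        simp [hf.eq_zero_of_closures E h, hg.eq_zero_of_closures E h] }
  neg_mem' {f} hf :=
    { additive := fun E i A B h => by
        simp only [Pi.neg_apply, hf.additive E i A B h]; abel
      perm := fun E σ => by simp only [Pi.neg_apply, hf.perm E σ, smul_neg]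
      eq_zero_of_eq := fun E i j h h' => by simp [hf.eq_zero_of_eq E i j h h']
      eq_zero_of_closures := fun E h => by simp [hf.eq_zero_of_closures E h] }

variable {X} {G}

/-- `U` is an open set containing the closures of all the `E i`. -/
def IsHull {m : ℕ} (E : Fin m → Bounded X) (U : Bounded X) : Prop :=
  IsOpen U.1 ∧ ∀ i, closure (E i).1 ⊆ U.1

theorem exists_isHull [LocallyCompactSpace X] [T2Space X] {m : ℕ} (E : Fin m → Bounded X) :
    ∃ U : Bounded X, IsHull E U := by
  obtain ⟨V, hV, hKV, hVc⟩ := exists_isOpen_superset_and_isCompact_closure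
    (isCompact_iUnion fun i => (E i).2)
  exact ⟨⟨V, hVc⟩, hV, fun i => (Set.subset_iUnion _ i).trans hKV⟩

theorem IsChain.cons_eq_cons_inter {n : ℕ} {f : (Fin (n + 2) → Bounded X) → G}
    (hf : IsChain X G (n + 1) f) (E : Fin (n + 1) → Bounded X) (U V : Bounded X)
    (hV : IsHull E V) :
    f (Fin.cons U E) = f (Fin.cons (U.sub (U.1 ∩ V.1) Set.inter_subset_left) E) := by
  have key := hf.additive (Fin.cons U E) 0 (U.sub (U.1 ∩ V.1) Set.inter_subset_left)
    (U.sub (U.1 \ V.1) Set.sdiff_subset)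
    (Set.disjoint_left.2 fun x hx hx' => hx'.2 hx.2)
  have hU : (U.sub (U.1 ∩ V.1) Set.inter_subset_left).union
      (U.sub (U.1 \ V.1) Set.sdiff_subset) = U :=
    Subtype.ext (Set.inter_union_sdiff U.1 V.1)
  rw [hU] at key
  simp only [Fin.update_cons_zero] at key
  rw [key, add_eq_left]
  refine hf.eq_zero_of_closures _ (Set.eq_empty_of_forall_notMem fun x hx => ?_)
  rw [Set.mem_iInter] at hx
  have h0 : x ∈ closure (U.1 \ V.1) := hx 0
  have h1 : x ∈ closure (E 0).1 := hx (Fin.succ 0)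
  obtain ⟨y, hyV, hyU⟩ := mem_closure_iff.1 h0 V.1 hV.1 (hV.2 0 h1)
  exact hyU.2 hyV

theorem IsChain.cons_eq_cons {n : ℕ} {f : (Fin (n + 2) → Bounded X) → G}
    (hf : IsChain X G (n + 1) f) (E : Fin (n + 1) → Bounded X) (U V : Bounded X)
    (hU : IsHull E U) (hV : IsHull E V) : f (Fin.cons U E) = f (Fin.cons V E) := by
  rw [hf.cons_eq_cons_inter E U V hV, hf.cons_eq_cons_inter E V U hU]
  congr 2
  exact Subtype.ext (Set.inter_comm _ _)

variable [LocallyCompactSpace X] [T2Space X]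

/-- The boundary `Δf(E_0, …, E_n) = f(U, E_0, …, E_n)`, where `U` is an open bounded set that
contains the closures of all the `E_i`. -/
noncomputable def boundaryFun {n : ℕ} (f : (Fin (n + 2) → Bounded X) → G) :
    (Fin (n + 1) → Bounded X) → G :=
  fun E => f (Fin.cons (exists_isHull E).choose E)

/-- The boundary does not depend on the choice of `U`. -/
theorem IsChain.boundaryFun_eq {n : ℕ} {f : (Fin (n + 2) → Bounded X) → G}
    (hf : IsChain X G (n + 1) f) (E : Fin (n + 1) → Bounded X) (U : Bounded X)
    (hU : IsHull E U) : boundaryFun f E = f (Fin.cons U E) :=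
  hf.cons_eq_cons E _ U (exists_isHull E).choose_spec hU

theorem IsChain.boundaryFun {n : ℕ} {f : (Fin (n + 2) → Bounded X) → G}
    (hf : IsChain X G (n + 1) f) : IsChain X G n (boundaryFun f) where
  additive E i A B h := by
    obtain ⟨U, hU⟩ := exists_isHull (Function.update E i (A.union B))
    have hle : ∀ C : Bounded X, C.1 ⊆ (A.union B).1 → IsHull (Function.update E i C) U := by
      intro C hC
      refine ⟨hU.1, fun j => ?_⟩
      have hj := hU.2 j
      by_cases hji : j = i
      · subst hji
        rw [Function.update_self] at hj ⊢
        exact (closure_mono hC).trans hj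
      · rwa [Function.update_of_ne hji] at hj ⊢
    rw [hf.boundaryFun_eq _ U hU, hf.boundaryFun_eq _ U (hle A Set.subset_union_left),
      hf.boundaryFun_eq _ U (hle B Set.subset_union_right)]
    simp only [Fin.cons_update]
    exact hf.additive _ _ A B h
  perm E σ := by
    obtain ⟨U, hU⟩ := exists_isHull E
    rw [hf.boundaryFun_eq (E ∘ σ) U ⟨hU.1, fun i => hU.2 (σ i)⟩, hf.boundaryFun_eq E U hU]
    have h := hf.perm (Fin.cons U E) (Equiv.Perm.decomposeFin.symm (0, σ))
    rw [Equiv.Perm.decomposeFin.symm_sign, if_pos rfl, one_mul] at h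
    rw [← h]
    congr 1
    funext i
    refine Fin.cases ?_ (fun j => ?_) i
    · simp
    · simp [Equiv.Perm.decomposeFin_symm_apply_succ]
  eq_zero_of_eq E i j h h' := by
    obtain ⟨U, hU⟩ := exists_isHull E
    rw [hf.boundaryFun_eq E U hU]
    exact hf.eq_zero_of_eq _ i.succ j.succ (by simpa using h) (by simpa using h')
  eq_zero_of_closures E h := by
    obtain ⟨U, hU⟩ := exists_isHull E
    rw [hf.boundaryFun_eq E U hU]
    refine hf.eq_zero_of_closures _ (Set.eq_empty_of_forall_notMem fun x hx => ?_)
    rw [Set.mem_iInter] at hx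
    exact (h ▸ Set.mem_iInter.2 fun i => by simpa using hx i.succ : x ∈ (∅ : Set X))

variable (X G)

/-- The boundary operator `Δ : K_{n+1}(X, G) → K_n(X, G)`. -/
noncomputable def boundary (n : ℕ) : chains X G (n + 1) →+ chains X G n where
  toFun f := ⟨boundaryFun f.1, f.2.boundaryFun⟩
  map_zero' := rfl
  map_add' _ _ := rfl

theorem boundary_boundary (n : ℕ) (f : chains X G (n + 2)) :
    boundary X G n (boundary X G (n + 1) f) = 0 := by
  refine Subtype.ext (funext fun E => ?_)
  obtain ⟨U, hU⟩ := exists_isHull E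
  obtain ⟨V, hV⟩ := exists_isHull (Fin.cons U E : Fin (n + 2) → Bounded X)
  change boundaryFun (boundaryFun f.1) E = 0
  have hf : IsChain X G (n + 2) f.1 := f.2
  rw [hf.boundaryFun.boundaryFun_eq E U hU, hf.boundaryFun_eq _ V hV]
  have key := hf.additive (Fin.cons V (Fin.cons U E)) 0 U (V.sub (V.1 \ U.1) Set.sdiff_subset)
    Set.disjoint_sdiff_right
  have hUV : U.union (V.sub (V.1 \ U.1) Set.sdiff_subset) = V :=
    Subtype.ext (Set.union_sdiff_cancel (subset_closure.trans (hV.2 0)))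
  rw [hUV] at key
  simp only [Fin.update_cons_zero] at key
  rw [key, hf.eq_zero_of_eq _ 0 1 (by simp) rfl, zero_add]
  refine hf.eq_zero_of_closures _ (Set.eq_empty_of_forall_notMem fun x hx => ?_)
  rw [Set.mem_iInter] at hx
  have h0 : x ∈ closure (V.1 \ U.1) := hx 0
  have h1 : x ∈ closure (E 0).1 := hx (Fin.succ (Fin.succ 0))
  obtain ⟨y, hyU, hyV⟩ := mem_closure_iff.1 h0 U.1 hU.1 (hU.2 0 h1)
  exact hyV.2 hyU

/-- The chain complex `K_*(X, G)` of Kolmogoroff chains. -/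
noncomputable def complex : ChainComplex AddCommGrpCat.{max u v} ℕ :=
  ChainComplex.of (fun n => AddCommGrpCat.of (chains X G n))
    (fun n => AddCommGrpCat.ofHom (boundary X G n))
    (fun n => AddCommGrpCat.hom_ext (AddMonoidHom.ext (boundary_boundary X G n)))

/-- The `n`-th Kolmogoroff homology group of `X` with coefficients in `G`. -/
noncomputable abbrev homology (n : ℕ) : AddCommGrpCat.{max u v} := (complex X G).homology n

end Kolmogoroff

/-! ## Čech cohomology of a pair, with integer coefficients -/

namespace Cech

variable (Y : Type u) [TopologicalSpace Y]

/-- An open cover of `Y`. -/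
structure OpenCover where
  /-- The members of the cover. -/
  sets : Set (Set Y)
  isOpen : ∀ U ∈ sets, IsOpen U
  covers : ⋃₀ sets = Set.univ

variable {Y}

/-- `α ≤ β` means that `β` is a refinement of `α`. -/
instance : Preorder (OpenCover Y) where
  le α β := ∀ V ∈ β.sets, ∃ U ∈ α.sets, V ⊆ U
  le_refl _ V hV := ⟨V, hV, subset_rfl⟩
  le_trans _ _ _ h h' W hW := by
    obtain ⟨V, hV, hWV⟩ := h' W hW
    obtain ⟨U, hU, hVU⟩ := h V hV
    exact ⟨U, hU, hWV.trans hVU⟩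

/-- The intersection of the sets of a finite sequence of members of a cover. -/
def inter {α : OpenCover Y} {n : ℕ} (s : Fin (n + 1) → α.sets) : Set Y :=
  ⋂ i, (s i : Set Y)

/-- The ordered `n`-simplices of the nerve of a cover: the sequences of `n + 1` members of the
cover whose intersection is nonempty. -/
abbrev Simplex (α : OpenCover Y) (n : ℕ) : Type u :=
  {s : Fin (n + 1) → α.sets // (inter s).Nonempty}

theorem inter_subset_comp {α : OpenCover Y} {m n : ℕ} (s : Fin (n + 1) → α.sets)
    (g : Fin (m + 1) → Fin (n + 1)) : inter s ⊆ inter (s ∘ g) :=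
  Set.subset_iInter fun j => Set.iInter_subset _ (g j)

/-- The `i`-th face of an ordered simplex. -/
def Simplex.face {α : OpenCover Y} {n : ℕ} (s : Simplex α (n + 1)) (i : Fin (n + 2)) :
    Simplex α n :=
  ⟨s.1 ∘ i.succAbove, s.2.mono (inter_subset_comp s.1 i.succAbove)⟩

/-- The integral `n`-cochains on the nerve of `α` relative to the nerve of the trace of `α` on
`A`: the functions on ordered simplices that vanish on those whose intersection meets `A`. -/
def cochains (A : Set Y) (α : OpenCover Y) (n : ℕ) : AddSubgroup (Simplex α n → ℤ) where
  carrier := {c | ∀ s : Simplex α n, (inter s.1 ∩ A).Nonempty → c s = 0}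
  zero_mem' _ _ := rfl
  add_mem' ha hb s hs := by simp [ha s hs, hb s hs]
  neg_mem' ha s hs := by simp [ha s hs]

variable (A : Set Y)

/-- The coboundary operator. -/
def coboundary (α : OpenCover Y) (n : ℕ) : cochains A α n →+ cochains A α (n + 1) where
  toFun c := ⟨fun s => ∑ i : Fin (n + 2), (-1) ^ (i : ℕ) * c.1 (s.face i), fun s hs =>
    Finset.sum_eq_zero fun i _ => by
      rw [c.2 (s.face i)
        (hs.mono (Set.inter_subset_inter_left A (inter_subset_comp s.1 i.succAbove))), mul_zero]⟩
  map_zero' := Subtype.ext (funext fun s => by simp)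
  map_add' c d := Subtype.ext (funext fun s => by simp [mul_add, Finset.sum_add_distrib])

theorem coboundary_coboundary (α : OpenCover Y) (n : ℕ) (c : cochains A α n) :
    coboundary A α (n + 1) (coboundary A α n c) = 0 := by
  refine Subtype.ext (funext fun s => ?_)
  change ∑ i : Fin (n + 3), (-1 : ℤ) ^ (i : ℕ) *
    ∑ j : Fin (n + 2), (-1) ^ (j : ℕ) * c.1 ((s.face i).face j) = 0
  simp only [Finset.mul_sum]
  rw [← Finset.sum_product', Finset.univ_product_univ]
  refine Finset.sum_involution (fun p _ => (p.1.succAbove p.2, p.2.predAbove p.1)) ?_ ?_ ?_ ?_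
  · rintro ⟨i, j⟩ -
    have hface : (s.face (i.succAbove j)).face (j.predAbove i) = (s.face i).face j := by
      refine Subtype.ext (funext fun k => ?_)
      exact congrArg s.1 (Fin.succAbove_succAbove_succAbove_predAbove i j k)
    have hsign : (-1 : ℤ) ^ ((i.succAbove j : Fin (n + 3)) : ℕ) *
        (-1) ^ ((j.predAbove i : Fin (n + 2)) : ℕ) = -((-1) ^ (i : ℕ) * (-1) ^ (j : ℕ)) := by
      rw [← pow_add, Fin.neg_one_pow_succAbove_add_predAbove, pow_add]
    simp only
    rw [hface, ← mul_assoc, ← mul_assoc, hsign]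
    ring
  · rintro ⟨i, j⟩ - - h
    exact Fin.succAbove_ne i j (congrArg Prod.fst h)
  · intro _ _
    exact Finset.mem_univ _
  · rintro ⟨i, j⟩ -
    exact Prod.ext (Fin.succAbove_succAbove_predAbove i j) (Fin.predAbove_predAbove_succAbove i j)

/-- The complex of relative cochains on the nerve of `α`. -/
def complex (α : OpenCover Y) : CochainComplex AddCommGrpCat.{u} ℕ :=
  CochainComplex.of (fun n => AddCommGrpCat.of (cochains A α n))
    (fun n => AddCommGrpCat.ofHom (coboundary A α n))
    (fun n => AddCommGrpCat.hom_ext (AddMonoidHom.ext (coboundary_coboundary A α n)))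

/-- A projection from the refinement `β` to `α`: it sends each member of `β` to a member of `α`
that contains it. -/
structure Projection (α β : OpenCover Y) where
  /-- The underlying map between the sets of vertices of the nerves. -/
  toFun : β.sets → α.sets
  subset : ∀ V : β.sets, (V : Set Y) ⊆ toFun V

/-- A choice of projection; any two projections induce the same map on cohomology. -/
noncomputable def projection {α β : OpenCover Y} (h : α ≤ β) : Projection α β where
  toFun V := ⟨(h V.1 V.2).choose, (h V.1 V.2).choose_spec.1⟩
  subset V := (h V.1 V.2).choose_spec.2

theorem Projection.inter_subset {α β : OpenCover Y} (p : Projection α β) {n : ℕ}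
    (s : Fin (n + 1) → β.sets) : inter s ⊆ inter (p.toFun ∘ s) :=
  Set.iInter_mono fun i => p.subset (s i)

/-- The map that a projection induces on relative cochains. -/
def Projection.pullback {α β : OpenCover Y} (p : Projection α β) (n : ℕ) :
    cochains A α n →+ cochains A β n where
  toFun c := ⟨fun s => c.1 ⟨p.toFun ∘ s.1, s.2.mono (p.inter_subset s.1)⟩, fun s hs =>
    c.2 _ (hs.mono (Set.inter_subset_inter_left A (p.inter_subset s.1)))⟩
  map_zero' := rfl
  map_add' _ _ := rfl

/-- The cochain map induced by a projection. -/
def Projection.map {α β : OpenCover Y} (p : Projection α β) : complex A α ⟶ complex A β :=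
  CochainComplex.ofHom (fun n => AddCommGrpCat.ofHom (p.pullback A n))
    (fun n => by
      simp only [complex, CochainComplex.of_d]
      rfl)

open Classical in
/-- The `n`-th Čech cohomology group of the pair `(Y, A)` with integer coefficients: the direct
limit, over all open covers of `Y` directed by refinement, of the cohomology groups of the pairs
of nerves. -/
abbrev cohomology (n : ℕ) : Type u :=
  AddCommGroup.DirectLimit (fun α : OpenCover Y => ((complex A α).homology n : Type u))
    (fun _ _ h => (HomologicalComplex.homologyMap ((projection h).map A) n).hom)

end Cech

/-! ## The group `Ext` of abelian groups -/

/-- `Ext¹(A, G)` for abelian groups `A` and `G`, possibly in different universes. -/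
abbrev ExtAb (A : Type u) (G : Type v) [AddCommGroup A] [AddCommGroup G] : Type (max u v) :=
  Abelian.Ext (ModuleCat.of ℤ (ULift.{v} A)) (ModuleCat.of ℤ (ULift.{u} G)) 1

universe w

/-!
Let `Y` be the one-point compactification of `X` and `p` the point at infinity. The bounded sets are
the subsets of `Y` whose closure does not contain `p`, and sets have closures with a common point
exactly if they belong to ultrafilters with a common limit. A tuple `E₀, …, Eₙ` of such sets
therefore gives an alternating integer function on the tuples of ultrafilters with a common limit,
the determinant of the `0`-`1` matrix of memberships. These functions generate a group `Cⁿ`, and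
they satisfy just the relations that a Kolmogoroff chain must respect: the chains are
`Hom(Cⁿ, G)`, and `Δ` is dual to the coboundary operator of `C`.

The functions in `Cⁿ` take finitely many values and factor through finite partitions of `Y`, so `Cⁿ`
is a subgroup of a free group of locally constant functions, hence projective. The closures of the
parts of a finite partition form a closed cover, which has the nerve of an open swelling; as every
open cover of `Y` is refined by such partitions, the cohomology of `C` is the Čech cohomology of
`(Y, p)`. The universal coefficient theorem for `Hom(C, G)` gives the exact sequence.
-/

namespace TupleCochain

variable {V W : Type*} {n : ℕ}

/-- The integral `n`-cochains on the full simplex with vertex set `V`. -/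
abbrev Cochain (V : Type*) (n : ℕ) : Type _ := (Fin (n + 1) → V) → ℤ

/-- The simplicial coboundary operator on cochains of the full simplex. -/
def δ : Cochain V n →+ Cochain V (n + 1) where
  toFun c s := ∑ i : Fin (n + 2), (-1) ^ (i : ℕ) * c (s ∘ i.succAbove)
  map_zero' := funext fun s => by simp
  map_add' c d := funext fun s => by simp [mul_add, Finset.sum_add_distrib]

theorem δ_apply (c : Cochain V n) (s : Fin (n + 2) → V) :
    δ c s = ∑ i : Fin (n + 2), (-1) ^ (i : ℕ) * c (s ∘ i.succAbove) := rfl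

/-- The contraction of the cochains of the full simplex onto the vertex `v`: evaluation on cones
with apex `v`. -/
def cone (v : V) : Cochain V (n + 1) →+ Cochain V n where
  toFun c s := c (Fin.cons v s)
  map_zero' := rfl
  map_add' _ _ := rfl

theorem cone_apply (v : V) (c : Cochain V (n + 1)) (s : Fin (n + 1) → V) :
    cone v c s = c (Fin.cons v s) := rfl

theorem ext_cone {c d : Cochain V (n + 1)} (h : ∀ v, cone v c = cone v d) : c = d :=
  funext fun s => Fin.cons_self_tail s ▸ congrFun (h (s 0)) (Fin.tail s)

theorem δ_const (z : ℤ) : δ (fun _ : Fin 1 → V => z) = 0 :=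
  funext fun s => by simp [δ_apply, Fin.sum_univ_two]

theorem cone_δ_zero (v : V) (c : Cochain V 0) : cone v (δ c) = c - fun _ => c fun _ => v := by
  funext s
  have h0 : (Fin.cons v s : Fin 2 → V) ∘ Fin.succAbove 0 = s := by
    funext j; simp
  have h1 : (Fin.cons v s : Fin 2 → V) ∘ Fin.succAbove 1 = fun _ => v := by
    funext j
    rw [Subsingleton.elim j 0]
    rfl
  rw [cone_apply, δ_apply, Fin.sum_univ_two, h0, h1]
  simp [sub_eq_add_neg]

theorem cone_δ (v : V) (c : Cochain V (n + 1)) : cone v (δ c) = c - δ (cone v c) := by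
  funext s
  have h0 : (Fin.cons v s : Fin (n + 3) → V) ∘ Fin.succAbove 0 = s := by
    funext j; simp
  have hsucc (i : Fin (n + 2)) : (Fin.cons v s : Fin (n + 3) → V) ∘ i.succ.succAbove =
      Fin.cons v (s ∘ i.succAbove) := by
    funext j
    cases j using Fin.cases <;> simp
  simp only [cone_apply, Pi.sub_apply, δ_apply, Fin.sum_univ_succ (n := n + 2), h0, hsucc,
    Fin.val_zero, Fin.val_succ, pow_zero, one_mul, pow_succ, mul_neg_one, neg_mul,
    Finset.sum_neg_distrib, sub_eq_add_neg]

theorem δ_δ (c : Cochain V n) : δ (δ c) = 0 := by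
  induction n with
  | zero =>
    exact ext_cone fun v => by
      rw [cone_δ, cone_δ_zero, map_sub, δ_const, sub_zero, sub_self, map_zero]
  | succ n ih =>
    exact ext_cone fun v => by
      rw [cone_δ, cone_δ, map_sub, ih, sub_zero, sub_self, map_zero]

/-- The pullback of cochains along a map of vertices. -/
def pull (φ : W → V) : Cochain V n →+ Cochain W n where
  toFun c s := c (φ ∘ s)
  map_zero' := rfl
  map_add' _ _ := rfl

theorem pull_apply (φ : W → V) (c : Cochain V n) (s : Fin (n + 1) → W) :
    pull φ c s = c (φ ∘ s) := rfl

theorem pull_δ (φ : W → V) (c : Cochain V n) : pull φ (δ c) = δ (pull φ c) := rfl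

section Homotopy

/-- A homotopy from `0` to the cochain map `T`, built by coning: at the tuple `s` of vertices of
`W` it contracts onto the chosen vertex `a n s` of `V`. -/
def homotopy (T : ∀ n, Cochain V n →+ Cochain W n) (a : ∀ n, (Fin (n + 1) → W) → V) :
    ∀ n, Cochain V (n + 1) →+ Cochain W n
  | 0 =>
    { toFun := fun c s => T 0 (cone (a 0 s) c) s
      map_zero' := funext fun s => by simp
      map_add' := fun c d => funext fun s => by simp }
  | n + 1 =>
    { toFun := fun c s => T (n + 1) (cone (a (n + 1) s) c) s -
        δ (homotopy T a n (cone (a (n + 1) s) c)) s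
      map_zero' := funext fun s => by simp
      map_add' := fun c d => funext fun s => by
        simp only [map_add, Pi.add_apply]; abel }

variable {T : ∀ n, Cochain V n →+ Cochain W n} {a : ∀ n, (Fin (n + 1) → W) → V}

theorem homotopy_zero_apply (c : Cochain V 1) (s : Fin 1 → W) :
    homotopy T a 0 c s = T 0 (cone (a 0 s) c) s := rfl

theorem homotopy_succ_apply (c : Cochain V (n + 2)) (s : Fin (n + 2) → W) :
    homotopy T a (n + 1) c s = T (n + 1) (cone (a (n + 1) s) c) s -
      δ (homotopy T a n (cone (a (n + 1) s) c)) s := rfl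

theorem homotopy_δ_zero (hconst : ∀ z : ℤ, T 0 (fun _ => z) = 0) (c : Cochain V 0) :
    homotopy T a 0 (δ c) = T 0 c :=
  funext fun s => by rw [homotopy_zero_apply, cone_δ_zero, map_sub, hconst, sub_zero]

theorem homotopy_δ_succ (hT : ∀ n c, T (n + 1) (δ c) = δ (T n c))
    (hconst : ∀ z : ℤ, T 0 (fun _ => z) = 0) (n : ℕ) (c : Cochain V (n + 1)) :
    homotopy T a (n + 1) (δ c) + δ (homotopy T a n c) = T (n + 1) c := by
  have hcobd (b : Cochain V n) : T (n + 1) (δ b) = δ (homotopy T a n (δ b)) := by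
    rw [hT]
    cases n with
    | zero => rw [homotopy_δ_zero hconst]
    | succ n => rw [← homotopy_δ_succ hT hconst n b, map_add, δ_δ, add_zero]
  funext s
  rw [Pi.add_apply, homotopy_succ_apply, cone_δ, map_sub, hcobd, map_sub, map_sub, Pi.sub_apply,
    Pi.sub_apply]
  ring

/-- `T` is carried by `Car`: the value of `T c` at `s` depends only on the values of `c` at the
tuples in `Car (range s)`. This is the condition in the method of acyclic carriers. -/
def IsCarried (Car : Set W → Set V) {m n : ℕ} (T : Cochain V m →+ Cochain W n) : Prop :=
  ∀ c s, (∀ t, Set.range t ⊆ Car (Set.range s) → c t = 0) → T c s = 0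

theorem IsCarried.sub {Car : Set W → Set V} {m n : ℕ} {T T' : Cochain V m →+ Cochain W n}
    (h : IsCarried Car T) (h' : IsCarried Car T') : IsCarried Car (T - T') := fun c s hc => by
  simp [h c s hc, h' c s hc]

theorem range_cons_subset {n : ℕ} {v : V} {t : Fin n → V} {A : Set V} (hv : v ∈ A)
    (ht : Set.range t ⊆ A) : Set.range (Fin.cons v t : Fin (n + 1) → V) ⊆ A := by
  rw [Fin.range_cons]
  exact Set.insert_subset hv ht

theorem isCarried_homotopy {Car : Set W → Set V} (hCar : Monotone Car)
    (hT : ∀ n, IsCarried Car (T n)) (ha : ∀ n s, a n s ∈ Car (Set.range s)) (n : ℕ) :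
    IsCarried Car (homotopy T a n) := by
  induction n with
  | zero =>
    intro c s hc
    exact hT 0 _ _ fun t ht => hc _ (range_cons_subset (ha 0 s) ht)
  | succ n ih =>
    intro c s hc
    have hTs : T (n + 1) (cone (a (n + 1) s) c) s = 0 :=
      hT _ _ _ fun t ht => hc _ (range_cons_subset (ha _ s) ht)
    have hface (i : Fin (n + 2)) :
        homotopy T a n (cone (a (n + 1) s) c) (s ∘ i.succAbove) = 0 :=
      ih _ _ fun t ht => hc _ <|
        range_cons_subset (ha _ s) (ht.trans (hCar (Set.range_comp_subset_range _ _)))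
    simp [homotopy_succ_apply, hTs, δ_apply, hface]

end Homotopy

/-- A cochain is alternating if permuting the vertices multiplies it by the sign. -/
def IsAlt (c : Cochain V n) : Prop :=
  ∀ (s : Fin (n + 1) → V) (σ : Equiv.Perm (Fin (n + 1))),
    c (s ∘ σ) = (Equiv.Perm.sign σ : ℤ) * c s

theorem swap_succ_succAbove (k j : Fin (n + 1)) :
    Equiv.swap k.castSucc k.succ (k.succ.succAbove j) = k.castSucc.succAbove j := by
  rw [Equiv.swap_apply_def]
  ext
  simp only [Fin.succAbove, Fin.lt_def, Fin.ext_iff, apply_ite Fin.val, Fin.val_castSucc,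
    Fin.val_succ]
  split_ifs <;> omega

namespace IsAlt

variable {c d : Cochain V n}

theorem zero : IsAlt (0 : Cochain V n) := fun s σ => by simp

theorem add (hc : IsAlt c) (hd : IsAlt d) : IsAlt (c + d) := fun s σ => by
  simp [hc s σ, hd s σ, mul_add]

theorem neg (hc : IsAlt c) : IsAlt (-c) := fun s σ => by simp [hc s σ]

theorem sub (hc : IsAlt c) (hd : IsAlt d) : IsAlt (c - d) :=
  sub_eq_add_neg c d ▸ hc.add hd.neg

theorem pull (hc : IsAlt c) (φ : W → V) : IsAlt (pull φ c) := fun s σ => hc (φ ∘ s) σ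

theorem apply_swap (hc : IsAlt c) (s : Fin (n + 1) → V) {i j : Fin (n + 1)} (h : i ≠ j) :
    c (s ∘ Equiv.swap i j) = -c s := by
  simp [hc s, Equiv.Perm.sign_swap h]

theorem apply_eq_zero (hc : IsAlt c) {s : Fin (n + 1) → V} (hs : ¬ Function.Injective s) :
    c s = 0 := by
  obtain ⟨i, j, hij, hne⟩ := Function.not_injective_iff.1 hs
  have hswap : s ∘ Equiv.swap i j = s := by
    rw [Equiv.comp_swap_eq_update, hij, Function.update_eq_self, ← hij, Function.update_eq_self]
  exact self_eq_neg.1 (by simpa only [hswap] using hc.apply_swap s hne)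

theorem δ_apply_swap (hc : IsAlt c) (s : Fin (n + 2) → V) (k : Fin (n + 1)) :
    δ c (s ∘ Equiv.swap k.castSucc k.succ) = -δ c s := by
  have hface : (s ∘ Equiv.swap k.castSucc k.succ) ∘ k.succ.succAbove = s ∘ k.castSucc.succAbove :=
    funext fun j => congrArg s (swap_succ_succAbove k j)
  have hface' : (s ∘ Equiv.swap k.castSucc k.succ) ∘ k.castSucc.succAbove = s ∘ k.succ.succAbove :=
    funext fun j => congrArg s (by rw [← swap_succ_succAbove, Equiv.swap_apply_self])
  rw [δ_apply, δ_apply, ← Equiv.sum_comp (Equiv.swap k.castSucc k.succ), ← Finset.sum_neg_distrib]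
  refine Finset.sum_congr rfl fun i _ => ?_
  obtain rfl | hi := eq_or_ne i k.castSucc
  · rw [Equiv.swap_apply_left, hface]
    simp [pow_succ]
  obtain rfl | hi' := eq_or_ne i k.succ
  · rw [Equiv.swap_apply_right, hface']
    simp [pow_succ]
  obtain ⟨x, hx⟩ := Fin.exists_succAbove_eq hi.symm
  obtain ⟨y, hy⟩ := Fin.exists_succAbove_eq hi'.symm
  have hxy : x ≠ y := by
    rintro rfl
    exact Fin.castSucc_lt_succ.ne (hx.symm.trans hy)
  rw [Equiv.swap_apply_of_ne_of_ne hi hi', ← hx, ← hy, Function.comp_assoc,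
    (Fin.succAbove_right_injective (p := i)).swap_comp x y, ← Function.comp_assoc,
    hc.apply_swap _ hxy, mul_neg]

theorem δ (hc : IsAlt c) : IsAlt (δ c) := by
  intro s σ
  have hσ : σ ∈ Submonoid.closure
      (Set.range fun i : Fin (n + 1) => Equiv.swap i.castSucc i.succ) := by
    rw [Equiv.Perm.mclosure_swap_castSucc_succ]; trivial
  induction hσ using Submonoid.closure_induction generalizing s with
  | mem x hx =>
    obtain ⟨k, rfl⟩ := hx
    rw [hc.δ_apply_swap, Equiv.Perm.sign_swap Fin.castSucc_lt_succ.ne]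
    simp
  | one => simp
  | mul x y _ _ hx hy =>
    rw [Equiv.Perm.coe_mul, ← Function.comp_assoc, hy, hx]
    simp only [map_mul, Units.val_mul]
    ring

theorem ext [LinearOrder V] (hc : IsAlt c) (hd : IsAlt d)
    (h : ∀ s, StrictMono s → c s = d s) : c = d := by
  funext s
  by_cases hs : Function.Injective s
  · have hsort : StrictMono (s ∘ Tuple.sort s) :=
      (Tuple.monotone_sort s).strictMono_of_injective (hs.comp (Tuple.sort s).injective)
    exact mul_left_cancel₀ (Units.ne_zero (Equiv.Perm.sign (Tuple.sort s)))
      (by rw [← hc, ← hd, h _ hsort])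
  · rw [hc.apply_eq_zero hs, hd.apply_eq_zero hs]

end IsAlt

section Alternation

/-- An arbitrary linear order on the vertices, to select one ordering of each finite set. -/
noncomputable abbrev arbitraryLinearOrder (V : Type*) : LinearOrder V :=
  IsWellOrder.linearOrder WellOrderingRel

attribute [local instance] arbitraryLinearOrder

open Classical in
/-- The alternating cochain with the same values as `c` on the tuples that increase in an arbitrary
linear order of the vertices. -/
noncomputable def alt : Cochain V n →+ Cochain V n where
  toFun c s := if Function.Injective s then
    (Equiv.Perm.sign (Tuple.sort s) : ℤ) * c (s ∘ Tuple.sort s) else 0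
  map_zero' := funext fun s => by simp
  map_add' c d := funext fun s => by
    by_cases h : Function.Injective s <;> simp [h, mul_add]

theorem alt_apply (c : Cochain V n) {s : Fin (n + 1) → V} (hs : Function.Injective s) :
    alt c s = (Equiv.Perm.sign (Tuple.sort s) : ℤ) * c (s ∘ Tuple.sort s) := if_pos hs

theorem alt_apply_of_strictMono (c : Cochain V n) {s : Fin (n + 1) → V} (hs : StrictMono s) :
    alt c s = c s := by
  rw [alt_apply c hs.injective, Tuple.sort_eq_refl_iff_monotone.2 hs.monotone]
  simp

theorem alt_eq_self (c : Cochain V 0) : alt c = c :=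
  funext fun s => alt_apply_of_strictMono c (Subsingleton.strictMono (α := Fin 1) s)

theorem isAlt_alt (c : Cochain V n) : IsAlt (alt c) := by
  intro s σ
  by_cases hs : Function.Injective s
  · have hsort : σ * Tuple.sort (s ∘ σ) = Tuple.sort s :=
      Equiv.ext fun i => hs (congrFun (Tuple.comp_perm_comp_sort_eq_comp_sort (f := s)) i)
    rw [alt_apply c (hs.comp σ.injective), alt_apply c hs,
      Tuple.comp_perm_comp_sort_eq_comp_sort, ← hsort, map_mul, Units.val_mul, ← mul_assoc,
      ← mul_assoc, ← Units.val_mul σ.sign, Int.units_mul_self, Units.val_one, one_mul]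
  · have hsσ : ¬ Function.Injective (s ∘ σ) := fun h => hs (σ.injective_comp s |>.1 h)
    simp [alt, hs, hsσ]

theorem IsAlt.alt_eq {c : Cochain V n} (hc : IsAlt c) : alt c = c :=
  (isAlt_alt c).ext hc fun _ hs => alt_apply_of_strictMono c hs

theorem alt_δ (c : Cochain V n) : alt (δ c) = δ (alt c) := by
  refine (isAlt_alt _).ext (isAlt_alt c).δ fun s hs => ?_
  rw [alt_apply_of_strictMono _ hs, δ_apply, δ_apply]
  refine Finset.sum_congr rfl fun i _ => ?_
  rw [alt_apply_of_strictMono c (hs.comp (Fin.strictMono_succAbove i))]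

theorem isCarried_alt : IsCarried id (alt (V := V) (n := n)) := by
  intro c s h
  by_cases hs : Function.Injective s
  · rw [alt_apply c hs, h _ (Set.range_comp_subset_range _ _), mul_zero]
  · exact if_neg hs

end Alternation

end TupleCochain

namespace NerveCochain

open TupleCochain

variable {Y V W : Type*} {Z : V → Set Y} {ZW : W → Set Y} {A : Set Y} {n : ℕ}

/-- A tuple of indices is a simplex of the nerve of the trace of the family `Z` on `A` if its
members have a common point in `A`. -/
def IsSimplex (Z : V → Set Y) (A : Set Y) (s : Fin (n + 1) → V) : Prop :=
  ∃ y ∈ A, ∀ i, y ∈ Z (s i)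

theorem IsSimplex.comp {φ : W → V} {s : Fin (n + 1) → W} (hs : IsSimplex ZW A s)
    (h : ∀ w, ZW w ⊆ Z (φ w)) : IsSimplex Z A (φ ∘ s) :=
  hs.imp fun _ hy => ⟨hy.1, fun i => h _ (hy.2 i)⟩

theorem IsSimplex.mono {Z' : V → Set Y} {s : Fin (n + 1) → V} (hs : IsSimplex Z A s)
    (h : ∀ v, Z v ⊆ Z' v) : IsSimplex Z' A s :=
  hs.comp (φ := id) h

theorem isSimplex_singleton {p : Y} {s : Fin (n + 1) → V} :
    IsSimplex Z {p} s ↔ ∀ i, p ∈ Z (s i) := by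
  simp [IsSimplex]

variable (Z A n) in
/-- The cochains that vanish on the nerve of the trace of `Z` on `A`. Cochains on the nerve of `Z`
relative to that of the trace on `A` are encoded as elements of `vanishingOn Z A n` modulo
`vanishingOn Z Set.univ n`. -/
def vanishingOn : AddSubgroup (Cochain V n) where
  carrier := {c | ∀ s, IsSimplex Z A s → c s = 0}
  zero_mem' _ _ := rfl
  add_mem' ha hb s hs := by simp [ha s hs, hb s hs]
  neg_mem' ha s hs := by simp [ha s hs]

theorem δ_mem_vanishingOn {c : Cochain V n} (hc : c ∈ vanishingOn Z A n) :
    δ c ∈ vanishingOn Z A (n + 1) := fun s hs => by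
  rw [δ_apply]
  refine Finset.sum_eq_zero fun i _ => ?_
  rw [hc (s ∘ i.succAbove) (hs.imp fun _ hy => ⟨hy.1, fun j => hy.2 _⟩), mul_zero]

variable (Z A n) in
/-- The relative cocycles of the nerve of `Z`. -/
def cocycles : AddSubgroup (Cochain V n) :=
  vanishingOn Z A n ⊓ (vanishingOn Z Set.univ (n + 1)).comap δ

variable (Z A) in
/-- The cochains that agree on the nerve of `Z` with the coboundary of a relative cochain. -/
def coboundaries : ∀ n, AddSubgroup (Cochain V n)
  | 0 => vanishingOn Z Set.univ 0
  | n + 1 => (vanishingOn Z A n).map δ ⊔ vanishingOn Z Set.univ (n + 1)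

theorem mem_coboundaries_succ {c : Cochain V (n + 1)} :
    c ∈ coboundaries Z A (n + 1) ↔
      ∃ b ∈ vanishingOn Z A n, c - δ b ∈ vanishingOn Z Set.univ (n + 1) := by
  simp only [coboundaries, AddSubgroup.mem_sup, AddSubgroup.mem_map]
  constructor
  · rintro ⟨_, ⟨b, hb, rfl⟩, d, hd, rfl⟩
    exact ⟨b, hb, by simpa using hd⟩
  · rintro ⟨b, hb, h⟩
    exact ⟨_, ⟨b, hb, rfl⟩, _, h, by abel⟩

theorem pull_mem_vanishingOn {c : Cochain V n} (hc : c ∈ vanishingOn Z A n) {φ : W → V}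
    (h : ∀ s : Fin (n + 1) → W, IsSimplex ZW A s → IsSimplex Z A (φ ∘ s)) :
    pull φ c ∈ vanishingOn ZW A n :=
  fun s hs => hc _ (h s hs)

theorem pull_mem_cocycles {c : Cochain V n} (hc : c ∈ cocycles Z A n) {φ : W → V}
    (h : ∀ w, ZW w ⊆ Z (φ w)) : pull φ c ∈ cocycles ZW A n :=
  ⟨pull_mem_vanishingOn hc.1 fun _ hs => hs.comp h,
    pull_mem_vanishingOn (c := δ c) hc.2 fun _ hs => hs.comp h⟩

theorem pull_mem_coboundaries {c : Cochain V n} (hc : c ∈ coboundaries Z A n) {φ : W → V}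
    (hA : ∀ {m : ℕ} (s : Fin (m + 1) → W), IsSimplex ZW A s → IsSimplex Z A (φ ∘ s))
    (huniv : ∀ {m : ℕ} (s : Fin (m + 1) → W),
      IsSimplex ZW Set.univ s → IsSimplex Z Set.univ (φ ∘ s)) :
    pull φ c ∈ coboundaries ZW A n := by
  cases n with
  | zero => exact pull_mem_vanishingOn hc huniv
  | succ n =>
    obtain ⟨b, hb, hcb⟩ := mem_coboundaries_succ.1 hc
    exact mem_coboundaries_succ.2
      ⟨pull φ b, pull_mem_vanishingOn hb hA, pull_mem_vanishingOn (c := c - δ b) hcb huniv⟩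

theorem pull_mem_coboundaries_of_subset {c : Cochain V n} (hc : c ∈ coboundaries Z A n)
    {φ : W → V} (h : ∀ w, ZW w ⊆ Z (φ w)) : pull φ c ∈ coboundaries ZW A n :=
  pull_mem_coboundaries hc (fun _ hs => hs.comp h) fun _ hs => hs.comp h

/-- The method of acyclic carriers: the carrier `Car` consists of full simplices, so the homotopy
obtained by coning stays in it. -/
theorem apply_mem_coboundaries_of_isCarried {T : ∀ n, Cochain V n →+ Cochain W n}
    {Car : Set W → Set V} (hT : ∀ n c, T (n + 1) (δ c) = δ (T n c))
    (hconst : ∀ z : ℤ, T 0 (fun _ => z) = 0) (hCar : Monotone Car)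
    (hTc : ∀ n, IsCarried Car (T n)) (hne : ∀ B : Set W, B.Nonempty → (Car B).Nonempty)
    (hmem : ∀ (B : Set W) (y : Y), (∀ w ∈ B, y ∈ ZW w) → ∀ v ∈ Car B, y ∈ Z v)
    {c : Cochain V n} (hc : c ∈ cocycles Z A n) : T n c ∈ coboundaries ZW A n := by
  choose a ha using fun (n : ℕ) (s : Fin (n + 1) → W) => hne _ (Set.range_nonempty s)
  have hvanish {m k : ℕ} {B : Set Y} {S : Cochain V m →+ Cochain W k} (hS : IsCarried Car S)
      {b : Cochain V m} (hb : b ∈ vanishingOn Z B m) : S b ∈ vanishingOn ZW B k := by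
    rintro s ⟨y, hyB, hy⟩
    exact hS b s fun t ht => hb t
      ⟨y, hyB, fun i => hmem _ y (Set.forall_mem_range.2 hy) _ (ht ⟨i, rfl⟩)⟩
  have hhom := isCarried_homotopy hCar hTc ha
  cases n with
  | zero => exact homotopy_δ_zero (a := a) hconst c ▸ hvanish (hhom 0) hc.2
  | succ n =>
    refine mem_coboundaries_succ.2 ⟨homotopy T a n c, hvanish (hhom n) hc.1, ?_⟩
    rw [← homotopy_δ_succ (a := a) hT hconst, add_sub_cancel_right]
    exact hvanish (hhom (n + 1)) hc.2

/-- `φ` and `ψ` are contiguous: the images of a simplex under both span a simplex, its carrier. -/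
theorem pull_sub_pull_mem_coboundaries {φ ψ : W → V} (hφ : ∀ w, ZW w ⊆ Z (φ w))
    (hψ : ∀ w, ZW w ⊆ Z (ψ w)) {c : Cochain V n} (hc : c ∈ cocycles Z A n) :
    pull φ c - pull ψ c ∈ coboundaries ZW A n := by
  refine apply_mem_coboundaries_of_isCarried (T := fun _ => pull φ - pull ψ)
    (Car := fun B => φ '' B ∪ ψ '' B) (fun n c => by simp [pull_δ])
    (fun z => funext fun s => by simp [pull_apply])
    (fun _ _ h => Set.union_subset_union (Set.image_mono h) (Set.image_mono h))
    (fun n => IsCarried.sub (fun c s h => h _ ?_) fun c s h => h _ ?_)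
    (fun B hB => (hB.image φ).mono Set.subset_union_left) ?_ hc
  · rw [Set.range_comp]; exact Set.subset_union_left
  · rw [Set.range_comp]; exact Set.subset_union_right
  · rintro B y hB v (⟨w, hw, rfl⟩ | ⟨w, hw, rfl⟩)
    · exact hφ _ (hB w hw)
    · exact hψ _ (hB w hw)

theorem alt_mem_vanishingOn {c : Cochain V n} (hc : c ∈ vanishingOn Z A n) :
    alt c ∈ vanishingOn Z A n := by
  rintro s ⟨y, hyA, hy⟩
  refine isCarried_alt c s fun t ht => hc t ⟨y, hyA, fun i => ?_⟩
  obtain ⟨j, hj⟩ := ht ⟨i, rfl⟩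
  exact hj ▸ hy j

theorem sub_alt_mem_coboundaries {c : Cochain V n} (hc : c ∈ cocycles Z A n) :
    c - alt c ∈ coboundaries Z A n :=
  apply_mem_coboundaries_of_isCarried (T := fun _ => AddMonoidHom.id _ - alt) (Car := id)
    (fun n c => by simp [alt_δ]) (fun z => by simp [alt_eq_self]) monotone_id
    (fun n => IsCarried.sub (fun c s h => h _ subset_rfl) isCarried_alt)
    (fun B hB => hB) (fun B y hB => hB) hc

theorem exists_isAlt_of_mem_coboundaries {c : Cochain V (n + 1)}
    (hc : c ∈ coboundaries Z A (n + 1)) (halt : IsAlt c) :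
    ∃ b ∈ vanishingOn Z A n, IsAlt b ∧ c - δ b ∈ vanishingOn Z Set.univ (n + 1) := by
  obtain ⟨b, hb, h⟩ := mem_coboundaries_succ.1 hc
  refine ⟨alt b, alt_mem_vanishingOn hb, isAlt_alt b, ?_⟩
  rw [← alt_δ, ← halt.alt_eq, ← map_sub]
  exact alt_mem_vanishingOn h

theorem pull_fst_alt_sub_pull_snd_alt_mem_coboundaries {T : V × W → Set Y}
    (hT : ∀ m, T m ⊆ Z m.1) (hTW : ∀ m, T m ⊆ ZW m.2) {q : W → V} (hq : ∀ w, ZW w ⊆ Z (q w))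
    {c : Cochain V n} (hc : c ∈ cocycles Z A n) :
    pull Prod.fst (alt c) - pull Prod.snd (alt (pull q c)) ∈
      coboundaries T A n := by
  have fst_alt : pull Prod.fst (c - alt c) ∈ coboundaries T A n :=
    pull_mem_coboundaries_of_subset (sub_alt_mem_coboundaries hc) hT
  have snd_alt : pull Prod.snd (pull q c - alt (pull q c)) ∈ coboundaries T A n :=
    pull_mem_coboundaries_of_subset (sub_alt_mem_coboundaries (pull_mem_cocycles hc hq)) hTW
  have contiguous : pull Prod.fst c - pull (q ∘ Prod.snd) c ∈
      coboundaries T A n :=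
    pull_sub_pull_mem_coboundaries hT (fun m => (hTW m).trans (hq m.2)) hc
  convert add_mem (sub_mem contiguous fst_alt) snd_alt using 1
  rw [map_sub, map_sub, show pull Prod.snd (pull q c) = pull (q ∘ Prod.snd) c from rfl]
  abel

end NerveCochain

/-! ### Projectivity of groups of finite-valued functions -/

/- `ℤ` is hereditary: a quotient of the divisible group `P → ℚ` is injective, so a section of
`f : (P →₀ ℤ) → P` arises by extending a map into such a quotient from `P` to `F` and lifting it. -/
theorem projective_of_injective {P F : Type*} [AddCommGroup P] [AddCommGroup F]
    [Module.Projective ℤ F] (i : P →ₗ[ℤ] F) (hi : Function.Injective i) :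
    Module.Projective ℤ P := by
  refine Module.Projective.of_lifting_property'' fun f hf => ?_
  let j : (P →₀ ℤ) →ₗ[ℤ] (P → ℚ) :=
    LinearMap.pi fun p => (Int.castAddHom ℚ).toIntLinearMap ∘ₗ Finsupp.lapply p
  have j_injective : Function.Injective j := fun x y h =>
    Finsupp.ext fun p => Int.cast_injective (congrFun h p)
  let K := (LinearMap.ker f).map j
  let g : P →ₗ[ℤ] (P → ℚ) ⧸ K := (LinearMap.ker f).mapQ K j (Submodule.le_comap_map j _) ∘ₗ
    (f.quotKerEquivOfSurjective hf).symm.toLinearMap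
  have g_apply (x : P →₀ ℤ) : g (f x) = K.mkQ (j x) := by
    rw [LinearMap.comp_apply, LinearEquiv.coe_coe, f.quotKerEquivOfSurjective_symm_apply]
    rfl
  let _ : DivisibleBy ((P → ℚ) ⧸ K) ℤ :=
    K.mkQ_surjective.divisibleBy K.mkQ fun a n => map_zsmul K.mkQ n a
  obtain ⟨g', hg'⟩ := (Module.Baer.of_divisible ((P → ℚ) ⧸ K)).extension_property i hi g
  obtain ⟨h, hh⟩ := Module.projective_lifting_property K.mkQ g' K.mkQ_surjective
  have exists_eq (p : P) : ∃ x, f x = p ∧ j x = h (i p) := by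
    obtain ⟨y, rfl⟩ := hf p
    have : K.mkQ (h (i (f y)) - j y) = 0 := by
      rw [map_sub, ← g_apply, ← hg', ← hh]
      exact sub_self _
    obtain ⟨z, hz, hzy⟩ := (Submodule.Quotient.mk_eq_zero K).1 this
    refine ⟨z + y, by rw [map_add, LinearMap.mem_ker.1 hz, zero_add], ?_⟩
    rw [map_add, hzy, sub_add_cancel]
  choose s hfs hjs using exists_eq
  refine ⟨(AddMonoidHom.mk' s fun p q => j_injective ?_).toIntLinearMap,
    LinearMap.ext hfs⟩
  rw [map_add, hjs, hjs, hjs, map_add, map_add]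

section FiniteValued

variable {S : Type u}

theorem exists_eventually_eq_of_finite_range {L : Type*} (U : Ultrafilter S) {f : S → L}
    (hf : (Set.range f).Finite) : ∃ l, ∀ᶠ x in U, f x = l := by
  have h : (⋃ l ∈ Set.range f, {x | f x = l}) ∈ U := Filter.univ_mem' fun x => by simp
  obtain ⟨l, -, hl⟩ := (Ultrafilter.finite_biUnion_mem_iff hf).1 h
  exact ⟨l, hl⟩

theorem eq_of_eventually_eq {L : Type*} {U : Ultrafilter S} {f : S → L} {l l' : L}
    (h : ∀ᶠ x in U, f x = l) (h' : ∀ᶠ x in U, f x = l') : l = l' := by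
  obtain ⟨x, hx, hx'⟩ := (h.and h').exists
  exact hx.symm.trans hx'

/-- The locally constant extension of a finite-valued function from a set to its space of
ultrafilters. -/
noncomputable def ultrafilterExtend {f : S → ℤ} (hf : (Set.range f).Finite) :
    LocallyConstant (Ultrafilter S) ℤ where
  toFun U := (exists_eventually_eq_of_finite_range U hf).choose
  isLocallyConstant := (IsLocallyConstant.iff_exists_open _).2 fun U =>
    ⟨{W | {x | f x = (exists_eventually_eq_of_finite_range U hf).choose} ∈ W},
      ultrafilter_isOpen_basic _, (exists_eventually_eq_of_finite_range U hf).choose_spec,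
      fun W hW => eq_of_eventually_eq (exists_eventually_eq_of_finite_range W hf).choose_spec hW⟩

theorem ultrafilterExtend_eventuallyEq {f : S → ℤ} (hf : (Set.range f).Finite)
    (U : Ultrafilter S) : ∀ᶠ x in U, f x = ultrafilterExtend hf U :=
  (exists_eventually_eq_of_finite_range U hf).choose_spec

theorem ultrafilterExtend_pure {f : S → ℤ} (hf : (Set.range f).Finite) (x : S) :
    ultrafilterExtend hf (pure x) = f x :=
  (ultrafilterExtend_eventuallyEq hf (pure x)).symm

theorem projective_of_finite_range (A : AddSubgroup (S → ℤ))
    (hA : ∀ f ∈ A, (Set.range f).Finite) : Module.Projective ℤ A := by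
  have : Module.Free ℤ (LocallyConstant (Ultrafilter S) ℤ) :=
    LocallyConstant.freeOfProfinite (Profinite.of (Ultrafilter S))
  let e : A →+ LocallyConstant (Ultrafilter S) ℤ :=
    AddMonoidHom.mk' (fun f => ultrafilterExtend (hA f.1 f.2)) fun f g =>
      LocallyConstant.ext fun U => by
        refine eq_of_eventually_eq (ultrafilterExtend_eventuallyEq (hA _ (f + g).2) U) ?_
        filter_upwards [ultrafilterExtend_eventuallyEq (hA f.1 f.2) U,
          ultrafilterExtend_eventuallyEq (hA g.1 g.2) U] with x hf hg
        exact congrArg₂ (· + ·) hf hg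
  refine projective_of_injective e.toIntLinearMap fun f g h => Subtype.ext (funext fun x => ?_)
  have hx : ultrafilterExtend (hA f.1 f.2) (pure x) = ultrafilterExtend (hA g.1 g.2) (pure x) :=
    DFunLike.congr_fun h (pure x)
  rwa [ultrafilterExtend_pure, ultrafilterExtend_pure] at hx

end FiniteValued

/-! ### Determinant cochains -/

namespace TupleCochain

variable {V W : Type*} {n : ℕ} {P : Fin (n + 1) → Set V} {t : Fin (n + 1) → V}

/-- The alternating cochain given by a tuple of sets: its value at `t` is the determinant of the
matrix whose entry at `(i, j)` is `1` if `t j ∈ P i` and `0` otherwise. -/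
noncomputable def detCochain (P : Fin (n + 1) → Set V) : Cochain V n := fun t =>
  (Matrix.of fun i j => (P i).indicator (1 : V → ℤ) (t j)).det

theorem detCochain_apply (P : Fin (n + 1) → Set V) (t : Fin (n + 1) → V) :
    detCochain P t = (Matrix.of fun i j => (P i).indicator (1 : V → ℤ) (t j)).det := rfl

theorem isAlt_detCochain (P : Fin (n + 1) → Set V) : IsAlt (detCochain P) := fun t σ =>
  (Matrix.det_permute' σ (Matrix.of fun i j => (P i).indicator (1 : V → ℤ) (t j))).trans <| by
    rw [Int.cast_id, detCochain_apply]

theorem detCochain_congr {P' : Fin (n + 1) → Set W} {t' : Fin (n + 1) → W}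
    (h : ∀ i j, t j ∈ P i ↔ t' j ∈ P' i) : detCochain P t = detCochain P' t' := by
  classical
  simp only [detCochain_apply, Set.indicator_apply, h, Pi.one_apply]

theorem detCochain_update_union (P : Fin (n + 1) → Set V) (i : Fin (n + 1)) {A B : Set V}
    (h : Disjoint A B) : detCochain (Function.update P i (A ∪ B)) =
      detCochain (Function.update P i A) + detCochain (Function.update P i B) := by
  funext t
  let row (C : Set V) : Fin (n + 1) → ℤ := fun j => C.indicator 1 (t j)
  have row_union : row (A ∪ B) = row A + row B :=
    funext fun j => congrFun (Set.indicator_union_of_disjoint h 1) (t j)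
  have detCochain_update (C : Set V) : detCochain (Function.update P i C) t =
      Matrix.detRowAlternating (Function.update (row ∘ P) i (row C)) := by
    rw [← Function.comp_update]
    rfl
  rw [Pi.add_apply, detCochain_update, detCochain_update, detCochain_update, row_union,
    AlternatingMap.map_update_add]

theorem detCochain_comp_perm (P : Fin (n + 1) → Set V) (σ : Equiv.Perm (Fin (n + 1))) :
    detCochain (P ∘ σ) = (Equiv.Perm.sign σ : ℤ) • detCochain P := funext fun t =>
  (Matrix.det_permute σ (Matrix.of fun i j => (P i).indicator (1 : V → ℤ) (t j))).trans <| by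
    rw [Int.cast_id, Pi.smul_apply, detCochain_apply, smul_eq_mul]

theorem detCochain_eq_zero_of_eq {i j : Fin (n + 1)} (hij : i ≠ j) (h : P i = P j) :
    detCochain P = 0 := funext fun t =>
  Matrix.det_zero_of_row_eq hij <| by
    funext k
    rw [Matrix.of_apply, Matrix.of_apply, h]

theorem detCochain_apply_eq_zero_of_forall_notMem (i : Fin (n + 1)) (h : ∀ j, t j ∉ P i) :
    detCochain P t = 0 :=
  Matrix.det_eq_zero_of_row_eq_zero i fun j => Set.indicator_of_notMem (h j) _

theorem detCochain_apply_eq_zero_of_notMem_forall (j : Fin (n + 1)) (h : ∀ i, t j ∉ P i) :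
    detCochain P t = 0 :=
  Matrix.det_eq_zero_of_column_eq_zero j fun i => Set.indicator_of_notMem (h i) _

theorem δ_detCochain_apply {s : Fin (n + 2) → V} {U : Set V} (h : ∀ j, s j ∈ U) :
    δ (detCochain P) s = detCochain (Fin.cons U P) s := by
  rw [detCochain_apply, Matrix.det_succ_row_zero, δ_apply]
  refine Finset.sum_congr rfl fun i _ => ?_
  rw [Matrix.of_apply, Fin.cons_zero, Set.indicator_of_mem (h i), Pi.one_apply, mul_one]
  rfl

open Classical in
theorem detCochain_apply_eq_sum_perm (P : Fin (n + 1) → Set V) (t : Fin (n + 1) → V) :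
    detCochain P t = ∑ σ : Equiv.Perm (Fin (n + 1)),
      if ∀ i, t (σ i) ∈ P i then (Equiv.Perm.sign σ : ℤ) else 0 := by
  rw [detCochain_apply, ← Matrix.det_transpose, Matrix.det_apply']
  simp [Set.indicator_apply, Finset.prod_ite_zero]

theorem detCochain_singleton_apply_self (ht : Function.Injective t) :
    detCochain (fun i => {t i}) t = 1 := by
  classical
  rw [detCochain_apply, ← Matrix.det_one (n := Fin (n + 1)) (R := ℤ)]
  refine congrArg Matrix.det (Matrix.ext fun i j => ?_)
  simp [Matrix.one_apply, Set.indicator_apply, ht.eq_iff, eq_comm]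

theorem eq_of_strictMono_of_range_subset {L : Type*} [LinearOrder L] {k : ℕ} {T t : Fin k → L}
    (hT : StrictMono T) (ht : StrictMono t) (h : Set.range T ⊆ Set.range t) : T = t := by
  refine (hT.range_inj ht).1 (Set.eq_of_subset_of_ncard_le h ?_ (Set.finite_range t))
  rw [Set.ncard_range_of_injective hT.injective, Set.ncard_range_of_injective ht.injective]

open Classical in
theorem IsAlt.eq_sum_detCochain [LinearOrder V] [Fintype V] {a : Cochain V n} (ha : IsAlt a) :
    a = ∑ T : Fin (n + 1) → V with StrictMono T, a T • detCochain fun i => {T i} := by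
  refine ha.ext (fun t σ => ?_) fun t ht => ?_
  · simp only [Finset.sum_apply, Pi.smul_apply, smul_eq_mul, Finset.mul_sum]
    exact Finset.sum_congr rfl fun T _ => by rw [isAlt_detCochain, mul_left_comm]
  · have htmem : t ∈ Finset.univ.filter fun T : Fin (n + 1) → V => StrictMono T := by simpa
    rw [Finset.sum_apply, Finset.sum_eq_single_of_mem t htmem, Pi.smul_apply,
      detCochain_singleton_apply_self ht.injective, smul_eq_mul, mul_one]
    intro T hT hne
    have hT : StrictMono T := (Finset.mem_filter.1 hT).2
    obtain ⟨_, ⟨i, rfl⟩, hi⟩ := Set.not_subset.1 fun h =>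
      hne (eq_of_strictMono_of_range_subset hT ht h)
    rw [Pi.smul_apply, detCochain_apply_eq_zero_of_forall_notMem i fun j h => hi ⟨j, h⟩, smul_zero]

end TupleCochain

/-! ### Alternating cochains on ultrafilters with a common limit -/

namespace UltraCochain

open TupleCochain NerveCochain Topology

variable (Y : Type u) [TopologicalSpace Y] {n : ℕ}

/-- The tuples of ultrafilters that have a common limit. -/
abbrev Point (n : ℕ) : Type u :=
  {s : Fin (n + 1) → Ultrafilter Y // ∃ y, ∀ i, (s i : Filter Y) ≤ 𝓝 y}

variable {Y}

/-- The `i`-th face of a tuple of ultrafilters. -/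
def Point.face (s : Point Y (n + 1)) (i : Fin (n + 2)) : Point Y n :=
  ⟨s.1 ∘ i.succAbove, s.2.imp fun _ hy _ => hy _⟩

/-- The coboundary operator on functions of tuples of ultrafilters. -/
def coboundary : (Point Y n → ℤ) →+ (Point Y (n + 1) → ℤ) where
  toFun F s := ∑ i : Fin (n + 2), (-1) ^ (i : ℕ) * F (s.face i)
  map_zero' := funext fun s => by simp
  map_add' c d := funext fun s => by simp [mul_add, Finset.sum_add_distrib]

theorem coboundary_apply (F : Point Y n → ℤ) (s : Point Y (n + 1)) :
    coboundary F s = ∑ i : Fin (n + 2), (-1) ^ (i : ℕ) * F (s.face i) := rfl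

/-- The restriction of a cochain to the tuples of ultrafilters that have a common limit. -/
def restrict : Cochain (Ultrafilter Y) n →+ (Point Y n → ℤ) where
  toFun c s := c s.1
  map_zero' := rfl
  map_add' _ _ := rfl

theorem restrict_surjective :
    Function.Surjective (restrict : Cochain (Ultrafilter Y) n →+ (Point Y n → ℤ)) := fun F =>
  ⟨Function.extend Subtype.val F 0, funext fun s => Subtype.val_injective.extend_apply F 0 s⟩

theorem coboundary_restrict (c : Cochain (Ultrafilter Y) n) :
    coboundary (restrict c) = restrict (δ c) := rfl

theorem coboundary_coboundary (F : Point Y n → ℤ) : coboundary (coboundary F) = 0 := by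
  obtain ⟨c, rfl⟩ := restrict_surjective F
  rw [coboundary_restrict, coboundary_restrict, δ_δ, map_zero]

/-- The alternating function on tuples of ultrafilters given by a tuple of sets: its value at `s`
is the determinant of the matrix that records which sets belong to which ultrafilters. -/
noncomputable def detFun (E : Fin (n + 1) → Set Y) : Point Y n → ℤ :=
  restrict (detCochain fun i => {u | E i ∈ u})

theorem detFun_update_union (E : Fin (n + 1) → Set Y) (i : Fin (n + 1)) {A B : Set Y}
    (h : Disjoint A B) : detFun (Function.update E i (A ∪ B)) =
      detFun (Function.update E i A) + detFun (Function.update E i B) := by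
  let members (C : Set Y) : Set (Ultrafilter Y) := {u | C ∈ u}
  have detFun_update (C : Set Y) : detFun (Function.update E i C) =
      restrict (detCochain (Function.update (members ∘ E) i (members C))) := by
    rw [← Function.comp_update]
    rfl
  have members_union : members (A ∪ B) = members A ∪ members B :=
    Set.ext fun u => Ultrafilter.union_mem_iff
  have members_disjoint : Disjoint (members A) (members B) :=
    Set.disjoint_left.2 fun u hA hB => u.empty_notMem <| by
      rw [← h.inter_eq]
      exact Filter.inter_mem hA hB
  rw [detFun_update, detFun_update, detFun_update, members_union,
    detCochain_update_union _ _ members_disjoint, map_add]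

theorem detFun_comp_perm (E : Fin (n + 1) → Set Y) (σ : Equiv.Perm (Fin (n + 1))) :
    detFun (E ∘ σ) = (Equiv.Perm.sign σ : ℤ) • detFun E :=
  (congrArg restrict (detCochain_comp_perm (fun i => {u | E i ∈ u}) σ)).trans
    (map_zsmul restrict _ _)

theorem detFun_eq_zero_of_eq {E : Fin (n + 1) → Set Y} {i j : Fin (n + 1)} (hij : i ≠ j)
    (h : E i = E j) : detFun E = 0 :=
  congrArg restrict (detCochain_eq_zero_of_eq hij (congrArg (fun C => {u | C ∈ u}) h))

theorem mem_closure_of_eventually {E : Set Y} {u : Ultrafilter Y} {y : Y} (hE : ∀ᶠ x in u, x ∈ E)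
    (hu : (u : Filter Y) ≤ 𝓝 y) : y ∈ closure E :=
  mem_closure_iff_ultrafilter.2 ⟨u, hE, hu⟩

theorem detFun_apply_eq_zero {E : Fin (n + 1) → Set Y} {s : Point Y n} {y : Y}
    (hy : ∀ i, (s.1 i : Filter Y) ≤ 𝓝 y) {i : Fin (n + 1)} (hi : y ∉ closure (E i)) :
    detFun E s = 0 :=
  detCochain_apply_eq_zero_of_forall_notMem i fun j h => hi (mem_closure_of_eventually h (hy j))

theorem detFun_eq_zero {E : Fin (n + 1) → Set Y} (h : ⋂ i, closure (E i) = ∅) : detFun E = 0 := by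
  funext s
  obtain ⟨y, hy⟩ := s.2
  obtain ⟨i, hi⟩ : ∃ i, y ∉ closure (E i) := by
    simpa using (Set.eq_empty_iff_forall_notMem.1 h) y
  exact detFun_apply_eq_zero hy hi

theorem coboundary_detFun (E : Fin (n + 1) → Set Y) {U : Set Y} (hU : IsOpen U)
    (hEU : ∀ i, closure (E i) ⊆ U) : coboundary (detFun E) = detFun (Fin.cons U E) := by
  funext s
  obtain ⟨y, hy⟩ := s.2
  by_cases hyU : y ∈ U
  · refine (δ_detCochain_apply (U := {u : Ultrafilter Y | U ∈ u})
      fun j => hy j (hU.mem_nhds hyU)).trans (detCochain_congr fun i j => ?_)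
    refine Fin.cases Iff.rfl (fun i => Iff.rfl) i
  · rw [detFun_apply_eq_zero hy (i := Fin.succ 0) fun h => hyU (hEU 0 h), coboundary_apply]
    refine Finset.sum_eq_zero fun i _ => ?_
    rw [detFun_apply_eq_zero (s := s.face i) (fun j => hy _) (i := 0) fun h => hyU (hEU 0 h),
      mul_zero]

variable (n) in
/-- The group of cochains generated by the functions `detFun E`, for tuples `E` of sets whose
closures do not contain `p`. -/
def cochains (p : Y) : AddSubgroup (Point Y n → ℤ) :=
  AddSubgroup.closure {F | ∃ E : Fin (n + 1) → Set Y, (∀ i, p ∉ closure (E i)) ∧ F = detFun E}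

variable {p : Y}

theorem detFun_mem {E : Fin (n + 1) → Set Y} (h : ∀ i, p ∉ closure (E i)) :
    detFun E ∈ cochains n p := AddSubgroup.subset_closure ⟨E, h, rfl⟩

theorem exists_isOpen_superset [RegularSpace Y] {E : Set Y} (hp : p ∉ closure E) :
    ∃ U, IsOpen U ∧ closure E ⊆ U ∧ p ∉ closure U := by
  obtain ⟨t, ht, htc, htE⟩ :=
    exists_mem_nhds_isClosed_subset (isClosed_closure.isOpen_compl.mem_nhds hp)
  refine ⟨tᶜ, htc.isOpen_compl, Set.subset_compl_comm.1 htE, ?_⟩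
  rwa [closure_compl, Set.notMem_compl_iff, mem_interior_iff_mem_nhds]

theorem detFun_mem_of_exists [RegularSpace Y] {E : Fin (n + 1) → Set Y}
    (h : ∃ i, p ∉ closure (E i)) : detFun E ∈ cochains n p := by
  obtain ⟨i, hi⟩ := h
  obtain ⟨U, hU, hEU, hUp⟩ := exists_isOpen_superset hi
  suffices detFun E = detFun fun j => E j ∩ U by
    rw [this]
    exact detFun_mem fun j hj => hUp (closure_mono Set.inter_subset_right hj)
  funext s
  obtain ⟨y, hy⟩ := s.2
  by_cases hyU : y ∈ U
  · exact detCochain_congr fun j k =>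
      ⟨fun h => Filter.inter_mem h (hy k (hU.mem_nhds hyU)),
        fun h => Filter.mem_of_superset h Set.inter_subset_left⟩
  · rw [detFun_apply_eq_zero hy fun h => hyU (hEU h), detFun_apply_eq_zero hy (i := i) fun h =>
      hyU (hEU (closure_mono Set.inter_subset_left h))]

/-! ### Finite labellings -/

section Labelling

variable {L M : Type*} {ρ : Y → L} {τ : Y → M}

/-- The closures of the fibres of a labelling of the points of `Y`. -/
abbrev fibreClosure (ρ : Y → L) (l : L) : Set Y :=
  closure (ρ ⁻¹' {l})

theorem fibreClosure_comp_subset (q : M → L) (m : M) :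
    fibreClosure τ m ⊆ fibreClosure (q ∘ τ) (q m) :=
  closure_mono fun _ hy => congrArg q hy

/-- `F` is the pullback of the cochain `a` under the labelling `ρ`: its value at a tuple of
ultrafilters along which `ρ` is constant is the value of `a` at the tuple of these constants. -/
def IsPull (ρ : Y → L) (a : Cochain L n) (F : Point Y n → ℤ) : Prop :=
  ∀ (s : Point Y n) (t : Fin (n + 1) → L), (∀ i, ∀ᶠ y in s.1 i, ρ y = t i) → F s = a t

theorem isSimplex_of_eventually {s : Point Y n} {t : Fin (n + 1) → L}
    (h : ∀ i, ∀ᶠ y in s.1 i, ρ y = t i) : IsSimplex (fibreClosure ρ) Set.univ t :=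
  s.2.imp fun _ hy => ⟨Set.mem_univ _, fun i => mem_closure_of_eventually (h i) (hy i)⟩

theorem exists_point {t : Fin (n + 1) → L} (ht : IsSimplex (fibreClosure ρ) Set.univ t) :
    ∃ s : Point Y n, ∀ i, ∀ᶠ y in s.1 i, ρ y = t i := by
  obtain ⟨y, -, hy⟩ := ht
  choose s hs hsy using fun i => mem_closure_iff_ultrafilter.1 (hy i)
  exact ⟨⟨s, y, hsy⟩, hs⟩

theorem exists_label (hρ : (Set.range ρ).Finite) (s : Point Y n) :
    ∃ t : Fin (n + 1) → L, ∀ i, ∀ᶠ y in s.1 i, ρ y = t i :=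
  ⟨_, fun i => (exists_eventually_eq_of_finite_range (s.1 i) hρ).choose_spec⟩

namespace IsPull

variable {a b : Cochain L n} {F F' : Point Y n → ℤ}

theorem coboundary (h : IsPull ρ a F) : IsPull ρ (δ a) (coboundary F) := fun s t ht => by
  rw [coboundary_apply, δ_apply]
  exact Finset.sum_congr rfl fun i _ => by rw [h (s.face i) (t ∘ i.succAbove) fun j => ht _]

theorem add (h : IsPull ρ a F) (h' : IsPull ρ b F') : IsPull ρ (a + b) (F + F') :=
  fun s t ht => congrArg₂ (· + ·) (h s t ht) (h' s t ht)

theorem neg (h : IsPull ρ a F) : IsPull ρ (-a) (-F) :=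
  fun s t ht => congrArg Neg.neg (h s t ht)

theorem comp {q : M → L} (h : IsPull (q ∘ τ) a F) : IsPull τ (pull q a) F := fun s t ht =>
  h s (q ∘ t) fun i => (ht i).mono fun _ hy => congrArg q hy

theorem unique (hρ : (Set.range ρ).Finite) (h : IsPull ρ a F) (h' : IsPull ρ a F') : F = F' := by
  funext s
  obtain ⟨t, ht⟩ := exists_label hρ s
  rw [h s t ht, h' s t ht]

end IsPull

theorem isPull_detFun (ρ : Y → L) (P : Fin (n + 1) → Set L) :
    IsPull ρ (detCochain P) (detFun fun i => ρ ⁻¹' P i) := fun s t ht => by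
  refine detCochain_congr fun i j => ?_
  have h : ∀ᶠ y in s.1 j, ρ y ∈ P i ↔ t j ∈ P i := (ht j).mono fun y hy => by rw [hy]
  exact (Filter.eventually_congr h).trans Filter.eventually_const

theorem exists_isPull_detFun {E : Fin (n + 1) → Set Y} (hE : ∀ i, p ∉ closure (E i)) :
    ∃ (L : Type) (_ : Finite L) (ρ : Y → L) (a : Cochain L n),
      IsAlt a ∧ a ∈ vanishingOn (fibreClosure ρ) {p} n ∧ IsPull ρ a (detFun E) := by
  let ρ : Y → Fin (n + 1) → Prop := fun y i => y ∈ E i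
  refine ⟨Fin (n + 1) → Prop, inferInstance, ρ, detCochain fun i => {l | l i}, isAlt_detCochain _,
    fun t ht => ?_, isPull_detFun ρ fun i => {l | l i}⟩
  refine detCochain_apply_eq_zero_of_notMem_forall 0 fun i hi => hE i ?_
  refine closure_mono (fun y hy => ?_) (isSimplex_singleton.1 ht 0)
  change ρ y i
  rwa [show ρ y = t 0 from hy]

theorem exists_isPull {F : Point Y n → ℤ} (hF : F ∈ cochains n p) :
    ∃ (L : Type) (_ : Finite L) (ρ : Y → L) (a : Cochain L n),
      IsAlt a ∧ a ∈ vanishingOn (fibreClosure ρ) {p} n ∧ IsPull ρ a F := by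
  induction hF using AddSubgroup.closure_induction with
  | mem F hF =>
    obtain ⟨E, hE, rfl⟩ := hF
    exact exists_isPull_detFun hE
  | zero =>
    exact ⟨Unit, inferInstance, fun _ => (), 0, IsAlt.zero, zero_mem _, fun _ _ _ => rfl⟩
  | add F F' _ _ h h' =>
    obtain ⟨L, _, ρ, a, ha, har, hF⟩ := h
    obtain ⟨L', _, ρ', a', ha', har', hF'⟩ := h'
    let τ : Y → L × L' := fun y => (ρ y, ρ' y)
    refine ⟨L × L', inferInstance, τ, pull Prod.fst a + pull Prod.snd a',
      (ha.pull _).add (ha'.pull _), add_mem ?_ ?_,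
      (IsPull.comp (τ := τ) (q := Prod.fst) hF).add (IsPull.comp (τ := τ) (q := Prod.snd) hF')⟩
    · exact pull_mem_vanishingOn har fun s hs =>
        hs.comp (fibreClosure_comp_subset (τ := τ) Prod.fst)
    · exact pull_mem_vanishingOn har' fun s hs =>
        hs.comp (fibreClosure_comp_subset (τ := τ) Prod.snd)
  | neg F _ h =>
    obtain ⟨L, _, ρ, a, ha, har, hF⟩ := h
    exact ⟨L, ‹_›, ρ, -a, ha.neg, neg_mem har, hF.neg⟩

theorem finite_range_of_mem {F : Point Y n → ℤ} (hF : F ∈ cochains n p) :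
    (Set.range F).Finite := by
  obtain ⟨L, _, ρ, a, -, -, h⟩ := exists_isPull hF
  refine (Set.finite_range a).subset ?_
  rintro _ ⟨s, rfl⟩
  obtain ⟨t, ht⟩ := exists_label (Set.toFinite (Set.range ρ)) s
  exact ⟨t, (h s t ht).symm⟩

instance projective_cochains : Module.Projective ℤ (cochains n p) :=
  projective_of_finite_range _ fun _ => finite_range_of_mem

theorem mem_of_isPull [RegularSpace Y] [Finite L] {a : Cochain L n} {F : Point Y n → ℤ}
    (ha : IsAlt a) (har : a ∈ vanishingOn (fibreClosure ρ) {p} n) (hF : IsPull ρ a F) :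
    F ∈ cochains n p := by
  classical
  have := Fintype.ofFinite L
  let _ : LinearOrder L := arbitraryLinearOrder _
  have hsum : F = ∑ T : Fin (n + 1) → L with StrictMono T,
      a T • detFun fun i => ρ ⁻¹' {T i} := by
    funext s
    obtain ⟨t, ht⟩ := exists_label (Set.toFinite (Set.range ρ)) s
    refine (hF s t ht).trans ((congrFun ha.eq_sum_detCochain t).trans ?_)
    rw [Finset.sum_apply, Finset.sum_apply]
    refine Finset.sum_congr rfl fun T _ => ?_
    rw [Pi.smul_apply, Pi.smul_apply, isPull_detFun ρ (fun i => {T i}) s t ht]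
  rw [hsum]
  refine sum_mem fun T _ => ?_
  by_cases hT : ∃ i, p ∉ fibreClosure ρ (T i)
  · exact zsmul_mem (detFun_mem_of_exists hT) _
  · rw [har T (isSimplex_singleton.2 (by simpa using hT)), zero_smul]
    exact zero_mem _

theorem coboundary_mem [RegularSpace Y] {F : Point Y n → ℤ} (hF : F ∈ cochains n p) :
    coboundary F ∈ cochains (n + 1) p := by
  obtain ⟨L, _, ρ, a, ha, har, h⟩ := exists_isPull hF
  exact mem_of_isPull ha.δ (δ_mem_vanishingOn har) h.coboundary

end Labelling

end UltraCochain

/-! ### Multiadditive functions of finite sets -/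

theorem sum_piFinset_cons {Λ M : Type*} [AddCommMonoid M] {k : ℕ} (A : Finset Λ)
    (J : Fin k → Finset Λ) (h : (Fin (k + 1) → Λ) → M) :
    ∑ t ∈ Fintype.piFinset (Fin.cons A J : Fin (k + 1) → Finset Λ), h t =
      ∑ l ∈ A, ∑ t ∈ Fintype.piFinset J, h (Fin.cons l t) := by
  rw [← Finset.sum_product']
  refine (Finset.sum_equiv (Fin.consEquiv fun _ => Λ) (fun q => ?_) fun _ _ => rfl).symm
  simp [Fin.consEquiv, Fin.forall_fin_succ]

section Multiadditive

variable {Λ G : Type*} [DecidableEq Λ] [AddCommGroup G]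

theorem eq_sum_singleton_of_additive {Q : Finset Λ → G}
    (hQ : ∀ A B, Disjoint A B → Q (A ∪ B) = Q A + Q B) (A : Finset Λ) :
    Q A = ∑ l ∈ A, Q {l} := by
  induction A using Finset.induction_on with
  | empty => simpa using hQ ∅ ∅ (Finset.disjoint_empty_left _)
  | insert l A hl ih =>
    rw [Finset.insert_eq, hQ _ _ (Finset.disjoint_singleton_left.2 hl), ← Finset.insert_eq,
      Finset.sum_insert hl, ih]

theorem eq_sum_singleton_of_multiadditive {k : ℕ} {P : (Fin k → Finset Λ) → G}
    (hP : ∀ J i A B, Disjoint A B →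
      P (Function.update J i (A ∪ B)) = P (Function.update J i A) + P (Function.update J i B))
    (J : Fin k → Finset Λ) : P J = ∑ t ∈ Fintype.piFinset J, P fun i => {t i} := by
  induction k with
  | zero =>
    rw [Fintype.piFinset_of_isEmpty, Fintype.sum_unique]
    exact congrArg P (Subsingleton.elim _ _)
  | succ k ih =>
    have additive_head (J' : Fin k → Finset Λ) (A B : Finset Λ) (hAB : Disjoint A B) :
        P (Fin.cons (A ∪ B) J') = P (Fin.cons A J') + P (Fin.cons B J') := by
      simpa only [Fin.update_cons_zero] using hP (Fin.cons ∅ J') 0 A B hAB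
    have additive_tail (l : Λ) (J' : Fin k → Finset Λ) :
        P (Fin.cons {l} J') = ∑ t ∈ Fintype.piFinset J', P (Fin.cons {l} fun i => {t i}) :=
      ih (P := fun J' => P (Fin.cons {l} J')) (fun J' i A B hAB => by
        simpa only [Fin.cons_update] using hP (Fin.cons {l} J') i.succ A B hAB) J'
    have cons_singleton (l : Λ) (t : Fin k → Λ) : (fun i => {(Fin.cons l t : Fin (k + 1) → Λ) i}) =
        (Fin.cons {l} fun i => {t i} : Fin (k + 1) → Finset Λ) :=
      funext <| Fin.cases rfl fun _ => rfl
    rw [← Fin.cons_self_tail J, sum_piFinset_cons,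
      eq_sum_singleton_of_additive (Q := fun A => P (Fin.cons A (Fin.tail J))) (additive_head _)]
    simp only [cons_singleton]
    exact Finset.sum_congr rfl fun l _ => additive_tail l _

end Multiadditive

open Classical in
theorem sum_eq_sum_strictMono_sum_perm {Λ G : Type*} [AddCommMonoid G] [Fintype Λ] [LinearOrder Λ]
    {k : ℕ} (h : (Fin k → Λ) → G) (h0 : ∀ t, ¬ Function.Injective t → h t = 0) :
    ∑ t, h t = ∑ T : Fin k → Λ with StrictMono T, ∑ σ : Equiv.Perm (Fin k), h (T ∘ σ) := by
  rw [← Finset.sum_product', ← Finset.sum_filter_of_ne (p := Function.Injective) fun t _ =>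
    not_imp_comm.1 (h0 t)]
  refine (Finset.sum_bij' (fun q _ => q.1 ∘ q.2)
    (fun t _ => (t ∘ Tuple.sort t, (Tuple.sort t)⁻¹)) ?_ ?_ ?_ ?_ fun _ _ => rfl).symm
  · rintro ⟨T, σ⟩ hT
    have hT' : StrictMono T := by simpa using hT
    simpa using hT'.injective
  · intro t ht
    have ht' : Function.Injective t := by simpa using ht
    simpa using (Tuple.monotone_sort t).strictMono_of_injective
      (ht'.comp (Tuple.sort t).injective)
  · rintro ⟨T, σ⟩ hT
    have hT' : StrictMono T := by simpa using hT
    have hsort : (T ∘ σ) ∘ Tuple.sort (T ∘ σ) = T := by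
      rw [Tuple.comp_perm_comp_sort_eq_comp_sort,
        Tuple.sort_eq_refl_iff_monotone.2 hT'.monotone]
      rfl
    have hσ : σ * Tuple.sort (T ∘ σ) = 1 :=
      Equiv.ext fun i => hT'.injective (congrFun hsort i)
    exact Prod.ext hsort (eq_inv_of_mul_eq_one_left hσ).symm
  · intro t _
    funext i
    simp

/-! ### Kolmogoroff chains as homomorphisms -/

namespace UltraCochain

open TupleCochain NerveCochain Topology

variable {Y : Type u} [TopologicalSpace Y] {n : ℕ}

/-- The sets whose closure does not contain `p`. -/
abbrev SetAway (p : Y) : Type u := {E : Set Y // p ∉ closure E}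

/-- The conditions on Kolmogoroff chains, for the subsets away from `p` instead of bounded sets. -/
structure IsChain {p : Y} {G : Type v} [AddCommGroup G] (f : (Fin (n + 1) → SetAway p) → G) :
    Prop where
  additive : ∀ (E : Fin (n + 1) → SetAway p) (i : Fin (n + 1)) (A B C : SetAway p),
    Disjoint A.1 B.1 → C.1 = A.1 ∪ B.1 →
      f (Function.update E i C) = f (Function.update E i A) + f (Function.update E i B)
  perm : ∀ (E : Fin (n + 1) → SetAway p) (σ : Equiv.Perm (Fin (n + 1))),
    f (E ∘ σ) = (Equiv.Perm.sign σ : ℤ) • f E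
  eq_zero_of_eq : ∀ (E : Fin (n + 1) → SetAway p) (i j : Fin (n + 1)),
    i ≠ j → E i = E j → f E = 0
  eq_zero_of_closures : ∀ E : Fin (n + 1) → SetAway p,
    ⋂ i, closure (E i).1 = ∅ → f E = 0

variable {p : Y} {G : Type v} [AddCommGroup G] {f : (Fin (n + 1) → SetAway p) → G}

section Fibres

variable {L : Type*} {ρ : Y → L}

/-- The fibre over a label, as a set away from `p`. -/
def fibre (ρ : Y → L) (l : {l // p ∉ fibreClosure ρ l}) : SetAway p :=
  ⟨ρ ⁻¹' {l.1}, l.2⟩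

/-- The union of a finite set of fibres whose closures do not contain `p`. -/
def fibreUnion (ρ : Y → L) (A : Finset {l // p ∉ fibreClosure ρ l}) : SetAway p :=
  ⟨⋃ l ∈ A, (fibre ρ l).1, by
    rw [Finset.closure_biUnion]
    simpa [fibre] using fun l hl _ => hl⟩

theorem fibreUnion_singleton (l : {l // p ∉ fibreClosure ρ l}) : fibreUnion ρ {l} = fibre ρ l :=
  Subtype.ext (Finset.set_biUnion_singleton l _)

theorem disjoint_fibreUnion {A B : Finset {l // p ∉ fibreClosure ρ l}} (h : Disjoint A B) :
    Disjoint (fibreUnion ρ A).1 (fibreUnion ρ B).1 := by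
  simp only [fibreUnion, Set.disjoint_iUnion_left, Set.disjoint_iUnion_right]
  intro l hl l' hl'
  refine (Set.disjoint_singleton.2 fun hll' => ?_).preimage ρ
  exact Finset.disjoint_left.1 h hl' (Subtype.ext hll' ▸ hl)

theorem eq_fibreUnion_filter [Fintype {l // p ∉ fibreClosure ρ l}] {E : SetAway p} {D : Set L}
    [DecidablePred (· ∈ D)] (h : E.1 = ρ ⁻¹' D) :
    E = fibreUnion ρ (Finset.univ.filter fun l => l.1 ∈ D) := by
  refine Subtype.ext (Set.ext fun y => ?_)
  simp only [fibreUnion, fibre, Finset.mem_filter, Finset.mem_univ, true_and, Set.mem_iUnion,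
    Set.mem_preimage, Set.mem_singleton_iff, exists_prop, h]
  refine ⟨fun hy => ⟨⟨ρ y, fun hp => E.2 (closure_mono (fun z hz => ?_) hp)⟩, hy, rfl⟩, ?_⟩
  · rw [h]
    exact (congrArg (· ∈ D) (show ρ z = ρ y from hz)).mpr hy
  · rintro ⟨l, hl, hy⟩
    rwa [hy]

theorem IsChain.fibreUnion_eq_sum (hf : IsChain f)
    (J : Fin (n + 1) → Finset {l // p ∉ fibreClosure ρ l}) :
    f (fibreUnion ρ ∘ J) = ∑ t ∈ Fintype.piFinset J, f (fibre ρ ∘ t) := by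
  classical
  refine (eq_sum_singleton_of_multiadditive (P := fun J => f (fibreUnion ρ ∘ J))
    (fun J i A B hAB => ?_) J).trans ?_
  · simp only [Function.comp_update]
    exact hf.additive _ i _ _ _ (disjoint_fibreUnion hAB) (Finset.set_biUnion_union A B _)
  · exact Finset.sum_congr rfl fun t _ => congrArg f (funext fun i => fibreUnion_singleton (t i))

open Classical in
theorem IsChain.eq_sum_detCochain [Fintype {l // p ∉ fibreClosure ρ l}]
    [LinearOrder {l // p ∉ fibreClosure ρ l}] (hf : IsChain f) {E : Fin (n + 1) → SetAway p}
    {D : Fin (n + 1) → Set L} (hE : ∀ i, (E i).1 = ρ ⁻¹' D i) :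
    f E = ∑ T : Fin (n + 1) → {l // p ∉ fibreClosure ρ l} with StrictMono T,
      detCochain D (Subtype.val ∘ T) • f (fibre ρ ∘ T) := by
  let J : Fin (n + 1) → Finset {l // p ∉ fibreClosure ρ l} := fun i =>
    Finset.univ.filter fun l => l.1 ∈ D i
  have f_fibre_eq_zero (t : Fin (n + 1) → {l // p ∉ fibreClosure ρ l})
      (ht : ¬ Function.Injective t) : f (fibre ρ ∘ t) = 0 := by
    simp only [Function.Injective, not_forall] at ht
    obtain ⟨i, j, hij, hne⟩ := ht
    exact hf.eq_zero_of_eq _ i j hne (congrArg (fibre ρ) hij)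
  have f_eq_sum : f E = ∑ t, if t ∈ Fintype.piFinset J then f (fibre ρ ∘ t) else 0 := by
    rw [Finset.sum_ite_mem, Finset.univ_inter]
    exact (congrArg f (funext fun i => eq_fibreUnion_filter (hE i))).trans (hf.fibreUnion_eq_sum J)
  rw [f_eq_sum, sum_eq_sum_strictMono_sum_perm]
  swap
  · intro t ht
    rw [f_fibre_eq_zero t ht, ite_self]
  refine Finset.sum_congr rfl fun T _ => ?_
  rw [detCochain_apply_eq_sum_perm, Finset.sum_smul]
  refine Finset.sum_congr rfl fun σ _ => ?_
  have mem_iff : T ∘ σ ∈ Fintype.piFinset J ↔ ∀ i, (T (σ i)).1 ∈ D i := by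
    simp only [Fintype.mem_piFinset, J, Finset.mem_filter, Finset.mem_univ, true_and,
      Function.comp_apply]
  rw [ite_smul, zero_smul]
  exact if_congr mem_iff (hf.perm (fibre ρ ∘ T) σ) rfl

theorem IsChain.sum_smul_eq_zero [Finite L] {ι : Type*} [Fintype ι] (hf : IsChain f) {c : ι → ℤ}
    {E : ι → Fin (n + 1) → SetAway p} {D : ι → Fin (n + 1) → Set L}
    (hE : ∀ k i, (E k i).1 = ρ ⁻¹' D k i)
    (hc : ∑ k, c k • detFun (fun i => (E k i).1) = 0) : ∑ k, c k • f (E k) = 0 := by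
  classical
  have := Fintype.ofFinite {l // p ∉ fibreClosure ρ l}
  let _ : LinearOrder {l // p ∉ fibreClosure ρ l} := arbitraryLinearOrder _
  simp only [hf.eq_sum_detCochain (hE _), Finset.smul_sum, ← mul_smul]
  rw [Finset.sum_comm]
  refine Finset.sum_eq_zero fun T _ => ?_
  rw [← Finset.sum_smul]
  by_cases hT : IsSimplex (fibreClosure ρ) Set.univ (Subtype.val ∘ T)
  · obtain ⟨s, hs⟩ := exists_point hT
    have hcoeff : ∑ k, c k * detCochain (D k) (Subtype.val ∘ T) = 0 := by
      refine Eq.trans ?_ (congrFun hc s)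
      rw [Finset.sum_apply]
      refine Finset.sum_congr rfl fun k _ => congrArg (c k * ·) ?_
      rw [funext (hE k)]
      exact (isPull_detFun ρ (D k) s _ hs).symm
    rw [hcoeff, zero_smul]
  · rw [hf.eq_zero_of_closures (fibre ρ ∘ T), smul_zero]
    exact Set.eq_empty_of_forall_notMem fun y hy => hT ⟨y, Set.mem_univ y, Set.mem_iInter.1 hy⟩

end Fibres

/-- The generator of the group of cochains given by a tuple of sets away from `p`. -/
noncomputable def generator (E : Fin (n + 1) → SetAway p) : cochains n p :=
  ⟨detFun (Subtype.val ∘ E), detFun_mem fun i => (E i).2⟩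

theorem coe_generator (E : Fin (n + 1) → SetAway p) :
    (generator E : Point Y n → ℤ) = detFun (Subtype.val ∘ E) := rfl

theorem IsChain.linearCombination_eq_zero (hf : IsChain f) {x : (Fin (n + 1) → SetAway p) →₀ ℤ}
    (hx : Finsupp.linearCombination ℤ generator x = 0) : Finsupp.linearCombination ℤ f x = 0 := by
  let ρ : Y → x.support × Fin (n + 1) → Prop := fun y q => y ∈ (q.1.1 q.2).1
  let D (E : x.support) (i : Fin (n + 1)) : Set (x.support × Fin (n + 1) → Prop) := {l | l (E, i)}
  have h := congrArg (cochains n p).subtype hx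
  rw [Finsupp.linearCombination_apply, Finsupp.sum, ← Finset.sum_coe_sort] at h ⊢
  rw [map_sum] at h
  exact hf.sum_smul_eq_zero (ρ := ρ) (D := D) (fun E i => rfl) h

theorem linearCombination_generator_surjective : Function.Surjective
    (Finsupp.linearCombination ℤ (generator (p := p) (n := n))) := by
  rintro ⟨F, hF⟩
  induction hF using AddSubgroup.closure_induction with
  | mem F hF =>
    obtain ⟨E, hE, rfl⟩ := hF
    exact ⟨Finsupp.single (fun i => ⟨E i, hE i⟩) 1, by
      rw [Finsupp.linearCombination_single, one_smul]; rfl⟩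
  | zero => exact ⟨0, map_zero _⟩
  | add F F' _ _ h h' =>
    obtain ⟨x, hx⟩ := h
    obtain ⟨x', hx'⟩ := h'
    exact ⟨x + x', by rw [map_add, hx, hx']; rfl⟩
  | neg F _ h =>
    obtain ⟨x, hx⟩ := h
    exact ⟨-x, by rw [map_neg, hx]; rfl⟩

theorem IsChain.exists_hom (hf : IsChain f) :
    ∃ φ : cochains n p →+ G, ∀ E, φ (generator E) = f E := by
  let ofFree := (Finsupp.linearCombination ℤ (generator (p := p) (n := n))).toAddMonoidHom
  let g := (Finsupp.linearCombination ℤ f).toAddMonoidHom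
  have hr : Function.RightInverse _ ofFree :=
    Function.rightInverse_surjInv linearCombination_generator_surjective
  let φ := ofFree.liftOfRightInverse _ hr ⟨g, fun x hx => hf.linearCombination_eq_zero hx⟩
  have hφ (x) : φ (ofFree x) = g x := ofFree.liftOfRightInverse_comp_apply _ hr _ x
  refine ⟨φ, fun E => ?_⟩
  simpa [ofFree, g] using hφ (Finsupp.single E 1)

theorem hom_ext {φ ψ : cochains n p →+ G} (h : ∀ E, φ (generator E) = ψ (generator E)) :
    φ = ψ := by
  refine AddMonoidHom.ext fun F => ?_
  obtain ⟨x, rfl⟩ := linearCombination_generator_surjective F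
  simp only [Finsupp.linearCombination_apply, Finsupp.sum, map_sum, map_zsmul, h]

theorem isChain_of_hom (φ : cochains n p →+ G) : IsChain fun E => φ (generator E) where
  additive E i A B C hAB hC := by
    rw [← map_add]
    refine congrArg φ (Subtype.ext ?_)
    rw [AddSubgroup.coe_add, coe_generator, coe_generator, coe_generator, Function.comp_update,
      Function.comp_update, Function.comp_update, hC, detFun_update_union _ _ hAB]
  perm E σ := by
    rw [← map_zsmul]
    exact congrArg φ (Subtype.ext (detFun_comp_perm (Subtype.val ∘ E) σ))
  eq_zero_of_eq E i j hij h := by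
    rw [← map_zero φ]
    exact congrArg φ (Subtype.ext
      (detFun_eq_zero_of_eq (E := Subtype.val ∘ E) hij (congrArg Subtype.val h)))
  eq_zero_of_closures E h := by
    rw [← map_zero φ]
    exact congrArg φ (Subtype.ext (detFun_eq_zero (E := Subtype.val ∘ E) h))

end UltraCochain

/-! ### Homology classes in complexes of abelian groups -/

section Subquotients

variable {M M' H H' : Type*} [AddCommGroup M] [AddCommGroup M'] [AddCommGroup H] [AddCommGroup H']

/-- The homomorphism `θ` exhibits `H` as the quotient of the subgroup `Z` by its elements that
lie in `B`. -/
structure IsSubquotient (Z B : AddSubgroup M) (θ : Z →+ H) : Prop where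
  surjective : Function.Surjective θ
  apply_eq_zero_iff : ∀ x, θ x = 0 ↔ x.1 ∈ B

variable {Z B : AddSubgroup M} {θ : Z →+ H}

theorem IsSubquotient.trans_equiv (h : IsSubquotient Z B θ) (e : H ≃+ H') :
    IsSubquotient Z B (e.toAddMonoidHom.comp θ) where
  surjective := e.surjective.comp h.surjective
  apply_eq_zero_iff x := e.map_eq_zero_iff.trans (h.apply_eq_zero_iff x)

theorem IsSubquotient.exists_comap_equiv (h : IsSubquotient Z B θ) (e : M' ≃+ M)
    {Z' B' : AddSubgroup M'} (hZ : ∀ x, x ∈ Z' ↔ e x ∈ Z) (hB : ∀ x, x ∈ B' ↔ e x ∈ B) :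
    ∃ θ' : Z' →+ H, IsSubquotient Z' B' θ' := by
  let eZ : Z' →+ Z := (e.toAddMonoidHom.comp Z'.subtype).codRestrict Z fun x => (hZ x.1).1 x.2
  have eZ_surjective : Function.Surjective eZ := fun y =>
    ⟨⟨e.symm y.1, (hZ _).2 ((e.apply_symm_apply y.1).symm ▸ y.2)⟩,
      Subtype.ext (e.apply_symm_apply y.1)⟩
  exact ⟨θ.comp eZ, h.surjective.comp eZ_surjective, fun x =>
    (h.apply_eq_zero_iff (eZ x)).trans (hB x.1).symm⟩

end Subquotients

namespace AbHomology

section ShortComplex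

variable {S T : ShortComplex AddCommGrpCat.{w}}

variable (S) in
/-- The homology class of a cycle in a short complex. -/
noncomputable def shortClass : S.g.hom.ker →+ S.homology :=
  (S.abCyclesIso.inv ≫ S.homologyπ).hom

theorem isSubquotient_shortClass : IsSubquotient S.g.hom.ker S.f.hom.range (shortClass S) := by
  have shortClass_eq : shortClass S = S.abHomologyIso.inv.hom.comp (QuotientAddGroup.mk' _) :=
    congrArg AddCommGrpCat.Hom.hom S.abLeftHomologyData.π_comp_homologyIso_inv.symm
  rw [shortClass_eq]
  constructor
  · exact ((AddCommGrpCat.epi_iff_surjective S.abHomologyIso.inv).1 inferInstance).comp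
      (QuotientAddGroup.mk'_surjective _)
  · intro x
    have inv_injective := (AddCommGrpCat.mono_iff_injective S.abHomologyIso.inv).1 inferInstance
    refine (map_eq_zero_iff S.abHomologyIso.inv.hom inv_injective).trans ?_
    rw [QuotientAddGroup.mk'_apply, QuotientAddGroup.eq_zero_iff]
    exact exists_congr fun y => Subtype.ext_iff

theorem homologyMap_shortClass (φ : S ⟶ T) {x : S.g.hom.ker} {y : T.g.hom.ker}
    (h : φ.τ₂.hom x.1 = y.1) :
    (ShortComplex.homologyMap φ).hom (shortClass S x) = shortClass T y := by
  have cyclesMap_eq : (ShortComplex.cyclesMap φ).hom (S.abCyclesIso.inv.hom x) =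
      T.abCyclesIso.inv.hom y := by
    refine (AddCommGrpCat.mono_iff_injective T.iCycles).1 inferInstance ?_
    refine Eq.trans ?_ (T.abCyclesIso_inv_apply_iCycles y).symm
    rw [← h, ← S.abCyclesIso_inv_apply_iCycles x]
    exact ConcreteCategory.congr_hom (ShortComplex.cyclesMap_i φ) _
  change _ = T.homologyπ.hom (T.abCyclesIso.inv.hom y)
  rw [← cyclesMap_eq]
  exact ConcreteCategory.congr_hom (ShortComplex.homologyπ_naturality φ) _

end ShortComplex

section HomologicalComplex

variable {ι : Type*} {c : ComplexShape ι} {K L : HomologicalComplex AddCommGrpCat.{w} c}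
  {i j k : ι}

variable (K) in
/-- The homology class of a cycle. -/
noncomputable def classMap (hj : c.next i = j) : (K.d i j).hom.ker →+ K.homology i :=
  (shortClass (K.sc i)).comp (AddSubgroup.inclusion (by subst hj; exact le_rfl))

theorem isSubquotient_classMap (hj : c.next i = j) (hk : c.prev i = k) :
    IsSubquotient (K.d i j).hom.ker (K.d k i).hom.range (classMap K hj) := by
  subst hj hk
  exact isSubquotient_shortClass (S := K.sc i)

theorem homologyMap_classMap (φ : K ⟶ L) (hj : c.next i = j) {x : (K.d i j).hom.ker}
    {y : (L.d i j).hom.ker} (h : (φ.f i).hom x.1 = y.1) :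
    (HomologicalComplex.homologyMap φ i).hom (classMap K hj x) = classMap L hj y := by
  subst hj
  exact homologyMap_shortClass ((HomologicalComplex.shortComplexFunctor _ _ i).map φ) h

end HomologicalComplex

end AbHomology

namespace CochainSeq

open AbHomology

variable {X X' : ℕ → Type w} [∀ n, AddCommGroup (X n)] [∀ n, AddCommGroup (X' n)]
  (d : ∀ n, X n →+ X (n + 1)) (sq : ∀ n x, d (n + 1) (d n x) = 0)
  (d' : ∀ n, X' n →+ X' (n + 1)) (sq' : ∀ n x, d' (n + 1) (d' n x) = 0)

/-- The coboundaries of a sequence of homomorphisms that starts in degree zero. -/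
def coboundaries : ∀ n, AddSubgroup (X n)
  | 0 => ⊥
  | n + 1 => (d n).range

/-- The cochain complex given by a sequence of groups and homomorphisms. -/
abbrev complex : CochainComplex AddCommGrpCat.{w} ℕ :=
  CochainComplex.of (fun n => AddCommGrpCat.of (X n)) (fun n => AddCommGrpCat.ofHom (d n))
    (fun n => AddCommGrpCat.hom_ext (AddMonoidHom.ext (sq n)))

theorem complex_d (n : ℕ) : (complex d sq).d n (n + 1) = AddCommGrpCat.ofHom (d n) :=
  CochainComplex.of_d (fun n => AddCommGrpCat.of (X n)) (fun n => AddCommGrpCat.ofHom (d n)) n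

theorem ker_complex_d (n : ℕ) : ((complex d sq).d n (n + 1)).hom.ker = (d n).ker := by
  rw [complex_d]
  rfl

/-- The cohomology class of a cocycle. -/
noncomputable def toHomology (n : ℕ) : (d n).ker →+ (complex d sq).homology n :=
  (classMap (complex d sq) (CochainComplex.next ℕ n)).comp
    (AddSubgroup.inclusion (ker_complex_d d sq n).ge)

theorem isSubquotient_toHomology (n : ℕ) :
    IsSubquotient (d n).ker (coboundaries d n) (toHomology d sq n) where
  surjective y := by
    obtain ⟨x, rfl⟩ := ((isSubquotient_classMap (CochainComplex.next ℕ n) rfl).surjective y)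
    exact ⟨⟨x.1, (ker_complex_d d sq n).le x.2⟩, rfl⟩
  apply_eq_zero_iff x := by
    cases n with
    | zero =>
      refine ((isSubquotient_classMap (CochainComplex.next ℕ 0)
        CochainComplex.prev_nat_zero).apply_eq_zero_iff _).trans ?_
      have d_eq_zero : (complex d sq).d 0 0 = 0 := (complex d sq).shape _ _ (by simp)
      rw [d_eq_zero]
      exact ⟨fun ⟨_, hy⟩ => hy.symm, fun hx => ⟨(0 : X 0), hx.symm⟩⟩
    | succ n =>
      refine ((isSubquotient_classMap (CochainComplex.next ℕ (n + 1))
        (CochainComplex.prev_nat_succ n)).apply_eq_zero_iff _).trans ?_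
      rw [complex_d]
      rfl

theorem homologyMap_toHomology (φ : complex d sq ⟶ complex d' sq') {n : ℕ} {x : (d n).ker}
    {y : (d' n).ker} (h : (φ.f n).hom x.1 = y.1) :
    (HomologicalComplex.homologyMap φ n).hom (toHomology d sq n x) = toHomology d' sq' n y :=
  homologyMap_classMap φ (CochainComplex.next ℕ n)
    (x := AddSubgroup.inclusion (ker_complex_d d sq n).ge x)
    (y := AddSubgroup.inclusion (ker_complex_d d' sq' n).ge y) h

end CochainSeq

/-! ### The universal coefficient theorem -/

section ExtConnecting

open Abelian

variable {C : Type*} [Category C] [Abelian C] [HasExt.{w} C] {S : ShortComplex C}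
  (hS : S.ShortExact) (Q : C)

/-- The connecting homomorphism `Hom(X₁, Q) → Ext¹(X₃, Q)` of a short exact sequence. -/
noncomputable def extConnecting : (S.X₁ ⟶ Q) →+ Ext S.X₃ Q 1 :=
  (hS.extClass.precomp Q (add_zero 1)).comp Ext.addEquiv₀.symm.toAddMonoidHom

theorem extConnecting_apply (f : S.X₁ ⟶ Q) :
    extConnecting hS Q f = hS.extClass.comp (Ext.mk₀ f) (add_zero 1) := rfl

theorem extConnecting_surjective [Projective S.X₂] :
    Function.Surjective (extConnecting hS Q) := by
  intro x
  obtain ⟨x₁, hx₁⟩ := Ext.contravariant_sequence_exact₃ hS Q x (Ext.eq_zero_of_projective _)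
    (add_zero 1)
  obtain ⟨f, rfl⟩ := (Ext.mk₀_bijective _ _).2 x₁
  exact ⟨f, hx₁⟩

theorem extConnecting_eq_zero_iff {f : S.X₁ ⟶ Q} :
    extConnecting hS Q f = 0 ↔ ∃ g : S.X₂ ⟶ Q, S.f ≫ g = f := by
  constructor
  · intro h
    obtain ⟨x₂, hx₂⟩ := Ext.contravariant_sequence_exact₁ hS Q _ (add_zero 1) h
    obtain ⟨g, rfl⟩ := (Ext.mk₀_bijective _ _).2 x₂
    rw [Ext.mk₀_comp_mk₀] at hx₂
    exact ⟨g, (Ext.mk₀_bijective _ _).1 hx₂⟩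
  · rintro ⟨g, rfl⟩
    rw [extConnecting_apply, ← Ext.mk₀_comp_mk₀]
    exact hS.extClass_comp_assoc _

end ExtConnecting

section Ext

variable {A Z H : Type u} [AddCommGroup A] [AddCommGroup Z] [AddCommGroup H]
  {G : Type v} [AddCommGroup G]

/-- Homomorphisms of abelian groups as `ℤ`-linear maps between lifts to larger universes. -/
def uliftHomEquiv (A : Type*) (B : Type*) [AddCommGroup A] [AddCommGroup B] :
    (A →+ B) ≃+ (ULift.{v} A →ₗ[ℤ] ULift.{w} B) :=
  (AddEquiv.ulift.symm.addMonoidHomCongrLeft.trans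
    AddEquiv.ulift.symm.addMonoidHomCongrRight).trans (addMonoidHomLequivInt ℤ).toAddEquiv

/-- A sequence of abelian groups as a short complex of `ℤ`-modules in a larger universe. -/
abbrev uliftShortComplex (ι : A →+ Z) (θ : Z →+ H) (hex : Function.Exact ι θ) :
    ShortComplex (ModuleCat.{max u v} ℤ) :=
  ShortComplex.mk (X₁ := ModuleCat.of ℤ (ULift.{v} A)) (X₂ := ModuleCat.of ℤ (ULift.{v} Z))
    (X₃ := ModuleCat.of ℤ (ULift.{v} H))
    (ModuleCat.ofHom (uliftHomEquiv A Z ι)) (ModuleCat.ofHom (uliftHomEquiv Z H θ))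
    (ModuleCat.hom_ext (LinearMap.ext fun x => ULift.ext _ _ (hex.apply_apply_eq_zero x.down)))

theorem shortExact_uliftShortComplex {ι : A →+ Z} {θ : Z →+ H} (hι : Function.Injective ι)
    (hθ : Function.Surjective θ) (hex : Function.Exact ι θ) :
    (uliftShortComplex.{u, v} ι θ hex).ShortExact where
  exact := by
    rw [ShortComplex.ShortExact.moduleCat_exact_iff_function_exact]
    refine fun z => ⟨fun hz => ?_, ?_⟩
    · obtain ⟨a, ha⟩ := (hex z.down).1 (congrArg ULift.down hz)
      exact ⟨⟨a⟩, congrArg ULift.up ha⟩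
    · rintro ⟨a, rfl⟩
      exact congrArg ULift.up (hex.apply_apply_eq_zero a.down)
  mono_f := (ModuleCat.mono_iff_injective _).2 fun _ _ h =>
    ULift.ext _ _ (hι (congrArg ULift.down h))
  epi_g := (ModuleCat.epi_iff_surjective _).2 fun x =>
    (hθ x.down).imp' ULift.up fun _ hz => congrArg ULift.up hz

theorem exists_connectingHom_extAb [Module.Projective ℤ Z] {ι : A →+ Z} {θ : Z →+ H}
    (hι : Function.Injective ι) (hθ : Function.Surjective θ) (hex : Function.Exact ι θ) :
    ∃ δ : (A →+ G) →+ ExtAb H G, Function.Surjective δ ∧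
      ∀ g, δ g = 0 ↔ ∃ h : Z →+ G, h.comp ι = g := by
  have shortExact := shortExact_uliftShortComplex.{u, v} hι hθ hex
  let Q := ModuleCat.of ℤ (ULift.{u} G)
  have : Projective (uliftShortComplex.{u, v} ι θ hex).X₂ :=
    (IsProjective.iff_projective _).1 (inferInstanceAs (Module.Projective ℤ (ULift.{v} Z)))
  let e := (uliftHomEquiv.{_, u} A G).trans
    (ModuleCat.homAddEquiv (M := ModuleCat.of ℤ (ULift.{v} A)) (N := Q)).symm
  let e' := (uliftHomEquiv.{_, u} Z G).trans
    (ModuleCat.homAddEquiv (M := ModuleCat.of ℤ (ULift.{v} Z)) (N := Q)).symm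
  refine ⟨(extConnecting shortExact Q).comp e.toAddMonoidHom,
    (extConnecting_surjective shortExact Q).comp e.surjective, fun g => ?_⟩
  refine (extConnecting_eq_zero_iff shortExact Q).trans ?_
  refine e'.surjective.exists.trans (exists_congr fun h => ?_)
  exact e.injective.eq_iff (a := h.comp ι)

end Ext

section DualComplex

variable {M N P E E' Q R : Type*} [AddCommGroup M] [AddCommGroup N] [AddCommGroup P]
  [AddCommGroup E] [AddCommGroup E'] [AddCommGroup Q] [AddCommGroup R]

theorem exists_ker_retraction [Module.Projective ℤ N] (d : M →+ N) :
    ∃ r : M →+ d.ker, ∀ x : d.ker, r x.1 = x := by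
  have := projective_of_injective (LinearMap.range d.toIntLinearMap).subtype
    Subtype.val_injective
  obtain ⟨s, hs⟩ := Module.projective_lifting_property d.toIntLinearMap.rangeRestrict
    LinearMap.id d.toIntLinearMap.surjective_rangeRestrict
  have d_s : ∀ y, d (s y) = y.1 := fun y => congrArg Subtype.val (LinearMap.congr_fun hs y)
  let r : M →+ M := AddMonoidHom.id M - s.toAddMonoidHom.comp
    d.toIntLinearMap.rangeRestrict.toAddMonoidHom
  have d_r : ∀ x, d (r x) = 0 := fun x => by
    change d (x - s (d.toIntLinearMap.rangeRestrict x)) = 0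
    rw [map_sub, d_s]
    exact sub_self (d x)
  refine ⟨r.codRestrict d.ker d_r, fun x => Subtype.ext ?_⟩
  have range_eq_zero : d.toIntLinearMap.rangeRestrict x.1 = 0 := Subtype.ext x.2
  change x.1 - s (d.toIntLinearMap.rangeRestrict x.1) = x.1
  rw [range_eq_zero, map_zero, sub_zero]

theorem exists_shortExact_of_surjective {A : Type*} [AddCommGroup A] {q : A →+ Q} {r : A →+ R}
    {δ : E' →+ E} {j : E' →+ A} (hq : Function.Surjective q) (hr : Function.Surjective r)
    (hδ : Function.Surjective δ) (hqj : ∀ g, q (j g) = 0 ↔ δ g = 0)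
    (hqr : ∀ f, q f = 0 → r f = 0) (hrj : Function.Exact j r) :
    ∃ (i : E →+ Q) (p : Q →+ R),
      Function.Injective i ∧ Function.Exact i p ∧ Function.Surjective p := by
  let i : E →+ Q := δ.liftOfSurjective hδ ⟨q.comp j, fun g hg => (hqj g).2 hg⟩
  have i_δ : ∀ g, i (δ g) = q (j g) := fun g => δ.liftOfRightInverse_comp_apply _ _ _ _
  let p : Q →+ R := q.liftOfSurjective hq ⟨r, hqr⟩
  have p_q : ∀ f, p (q f) = r f := fun f => q.liftOfRightInverse_comp_apply _ _ _ _
  refine ⟨i, p, (injective_iff_map_eq_zero i).2 fun x hx => ?_, fun y => ⟨fun hy => ?_, ?_⟩,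
    fun y => (hr y).imp' q fun f hf => (p_q f).trans hf⟩
  · obtain ⟨g, rfl⟩ := hδ x
    exact (hqj g).1 ((i_δ g).symm.trans hx)
  · obtain ⟨f, rfl⟩ := hq y
    obtain ⟨g, rfl⟩ := (hrj f).1 ((p_q f).symm.trans hy)
    exact ⟨δ g, i_δ g⟩
  · rintro ⟨x, rfl⟩
    obtain ⟨g, rfl⟩ := hδ x
    rw [i_δ, p_q, hrj.apply_apply_eq_zero]

end DualComplex

section Annihilator

variable {M N P H : Type*} [AddCommGroup M] [AddCommGroup N] [AddCommGroup P] [AddCommGroup H]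
  {G : Type*} [AddCommGroup G]

/-- The group of homomorphisms to `G` that vanish on the subgroup `B`. -/
def annihilatorHom (B : AddSubgroup M) (G : Type*) [AddCommGroup G] : AddSubgroup (M →+ G) where
  carrier := {f | ∀ b ∈ B, f b = 0}
  zero_mem' _ _ := rfl
  add_mem' hf hg b hb := by simp [hf b hb, hg b hb]
  neg_mem' hf b hb := by simp [hf b hb]

namespace IsSubquotient

variable {Z B : AddSubgroup M} {θ : Z →+ H} (h : IsSubquotient Z B θ)
include h

theorem exists_evaluation (f : annihilatorHom B G) : ∃ φ : H →+ G, ∀ x, φ (θ x) = f.1 x.1 :=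
  ⟨θ.liftOfSurjective h.surjective
    ⟨f.1.comp Z.subtype, fun x hx => f.2 _ ((h.apply_eq_zero_iff x).1 hx)⟩,
    fun _ => θ.liftOfRightInverse_comp_apply _ _ _ _⟩

/-- The action on the subquotient `H` of a homomorphism that vanishes on `B`. -/
noncomputable def evaluation : annihilatorHom B G →+ (H →+ G) :=
  AddMonoidHom.mk' (fun f => (h.exists_evaluation f).choose) fun f g =>
    AddMonoidHom.ext fun y => by
      obtain ⟨x, rfl⟩ := h.surjective y
      rw [AddMonoidHom.add_apply, (h.exists_evaluation f).choose_spec,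
        (h.exists_evaluation g).choose_spec, (h.exists_evaluation (f + g)).choose_spec]
      rfl

theorem evaluation_apply (f : annihilatorHom B G) (x : Z) : h.evaluation f (θ x) = f.1 x.1 :=
  (h.exists_evaluation f).choose_spec x

theorem evaluation_eq_zero_iff {f : annihilatorHom B G} :
    h.evaluation f = 0 ↔ Z ≤ f.1.ker := by
  rw [DFunLike.ext_iff, h.surjective.forall]
  exact ⟨fun hf x hx => (h.evaluation_apply f ⟨x, hx⟩).symm.trans (hf ⟨x, hx⟩),
    fun hf x => (h.evaluation_apply f x).trans (hf x.2)⟩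

end IsSubquotient

section Differential

variable {d : M →+ N} {B : AddSubgroup M}

/-- The homomorphism on `M` induced by a homomorphism on the range of `d`. -/
def rangePrecomp (hB : B ≤ d.ker) : (d.range →+ G) →+ annihilatorHom B G :=
  (AddMonoidHom.compHom' d.rangeRestrict).codRestrict _ fun g b hb => by
    have range_eq_zero : d.rangeRestrict b = 0 := Subtype.ext (hB hb)
    exact (congrArg g range_eq_zero).trans g.map_zero

theorem exact_rangePrecomp_evaluation {θ : d.ker →+ H} (h : IsSubquotient d.ker B θ)
    (hB : B ≤ d.ker) :
    Function.Exact (rangePrecomp hB) (h.evaluation : annihilatorHom B G →+ (H →+ G)) := by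
  refine fun f => h.evaluation_eq_zero_iff.trans ⟨fun hf => ?_, ?_⟩
  · let g : d.range →+ G := d.rangeRestrict.liftOfSurjective d.rangeRestrict_surjective
      ⟨f.1, d.ker_rangeRestrict.le.trans hf⟩
    exact ⟨g, Subtype.ext (d.rangeRestrict.liftOfRightInverse_comp _
      (Function.rightInverse_surjInv d.rangeRestrict_surjective) _)⟩
  · rintro ⟨g, rfl⟩ x hx
    have range_eq_zero : d.rangeRestrict x = 0 := Subtype.ext hx
    exact (congrArg g range_eq_zero).trans g.map_zero

theorem evaluation_surjective [Module.Projective ℤ N] {θ : d.ker →+ H}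
    (h : IsSubquotient d.ker B θ) (hB : B ≤ d.ker) :
    Function.Surjective (h.evaluation : annihilatorHom B G →+ (H →+ G)) := by
  intro φ
  obtain ⟨r, r_apply⟩ := exists_ker_retraction d
  refine ⟨⟨(φ.comp θ).comp r, fun b hb => ?_⟩, AddMonoidHom.ext fun y => ?_⟩
  · have θ_eq_zero : θ ⟨b, hB hb⟩ = 0 := (h.apply_eq_zero_iff _).2 hb
    rw [AddMonoidHom.comp_apply, AddMonoidHom.comp_apply, r_apply ⟨b, hB hb⟩, θ_eq_zero, map_zero]
  · obtain ⟨x, rfl⟩ := h.surjective y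
    exact (h.evaluation_apply _ x).trans (congrArg (φ.comp θ) (r_apply x))

theorem rangePrecomp_mem_range_iff [Module.Projective ℤ P] {d' : N →+ P} (hd : d.range ≤ d'.ker)
    (hB : B ≤ d.ker) {g : d.range →+ G} :
    (rangePrecomp hB g).1 ∈ (AddMonoidHom.compHom' (P := G) d).range ↔
      ∃ h : d'.ker →+ G, h.comp (AddSubgroup.inclusion hd) = g := by
  constructor
  · rintro ⟨F, hF⟩
    refine ⟨F.comp d'.ker.subtype, AddMonoidHom.ext ?_⟩
    rintro ⟨_, x, rfl⟩
    exact DFunLike.congr_fun hF x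
  · rintro ⟨h, rfl⟩
    obtain ⟨r, r_apply⟩ := exists_ker_retraction d'
    exact ⟨h.comp r, AddMonoidHom.ext fun x => congrArg h (r_apply ⟨d x, hd ⟨x, rfl⟩⟩)⟩

end Differential

end Annihilator

namespace CochainSeq

variable {X : ℕ → Type u} [∀ n, AddCommGroup (X n)] {d : ∀ n, X n →+ X (n + 1)}
  {G : Type v} [AddCommGroup G]

theorem coboundaries_le_ker (sq : ∀ n x, d (n + 1) (d n x) = 0) :
    ∀ n, coboundaries d n ≤ (d n).ker
  | 0 => bot_le
  | n + 1 => by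
    rintro _ ⟨x, rfl⟩
    exact sq n x

section Dual

variable {K : ChainComplex AddCommGrpCat.{w} ℕ} (e : ∀ n, (X n →+ G) ≃+ K.X n)
  (he : ∀ n φ, (K.d (n + 1) n).hom (e (n + 1) φ) = e n (φ.comp (d n)))
include he

theorem exists_next_mem_annihilatorHom_iff (n : ℕ) : ∃ j, (ComplexShape.down ℕ).next n = j ∧
    ∀ φ, φ ∈ annihilatorHom (coboundaries d n) G ↔ e n φ ∈ (K.d n j).hom.ker := by
  cases n with
  | zero =>
    refine ⟨0, ChainComplex.next_nat_zero, fun φ => ?_⟩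
    have d_eq_zero : K.d 0 0 = 0 := K.shape 0 0 (by simp)
    rw [d_eq_zero]
    refine iff_of_true ?_ rfl
    rintro _ rfl
    exact map_zero φ
  | succ n =>
    refine ⟨n, ChainComplex.next_nat_succ n, fun φ => ?_⟩
    rw [AddMonoidHom.mem_ker, he, (e n).map_eq_zero_iff, DFunLike.ext_iff]
    exact ⟨fun h y => h _ ⟨y, rfl⟩, fun h => by rintro _ ⟨y, rfl⟩; exact h y⟩

theorem exists_isSubquotient_dual (n : ℕ) :
    ∃ q : annihilatorHom (coboundaries d n) G →+ K.homology n,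
      IsSubquotient _ (AddMonoidHom.compHom' (P := G) (d n)).range q := by
  obtain ⟨j, hj, mem_iff⟩ := exists_next_mem_annihilatorHom_iff e he n
  refine (AbHomology.isSubquotient_classMap (K := K) hj (ChainComplex.prev ℕ n)).exists_comap_equiv
    (e n) mem_iff fun φ => ⟨?_, ?_⟩
  · rintro ⟨F, rfl⟩
    exact ⟨e (n + 1) F, he n F⟩
  · rintro ⟨y, hy⟩
    obtain ⟨F, rfl⟩ := (e (n + 1)).surjective y
    exact ⟨F, (e n).injective ((he n F).symm.trans hy)⟩

theorem exists_universalCoefficients [∀ n, Module.Projective ℤ (X n)]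
    (sq : ∀ n x, d (n + 1) (d n x) = 0) (n : ℕ) {H H' : Type u} [AddCommGroup H]
    [AddCommGroup H'] {θ : (d n).ker →+ H} (hθ : IsSubquotient _ (coboundaries d n) θ)
    {θ' : (d (n + 1)).ker →+ H'} (hθ' : IsSubquotient _ (coboundaries d (n + 1)) θ') :
    ∃ (i : ExtAb H' G →+ K.homology n) (p : K.homology n →+ (H →+ G)),
      Function.Injective i ∧ Function.Exact i p ∧ Function.Surjective p := by
  have range_le : (d n).range ≤ (d (n + 1)).ker := coboundaries_le_ker sq (n + 1)
  have exact_θ' : Function.Exact (AddSubgroup.inclusion range_le) θ' := fun x =>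
    (hθ'.apply_eq_zero_iff x).trans ⟨fun hx => ⟨⟨x.1, hx⟩, rfl⟩, fun ⟨y, hy⟩ => hy ▸ y.2⟩
  have : Module.Projective ℤ (d (n + 1)).ker := projective_of_injective
    (d (n + 1)).ker.subtype.toIntLinearMap Subtype.val_injective
  obtain ⟨δ, δ_surjective, δ_eq_zero_iff⟩ := exists_connectingHom_extAb (G := G)
    (AddSubgroup.inclusion_injective range_le) hθ'.surjective exact_θ'
  obtain ⟨q, hq⟩ := exists_isSubquotient_dual e he n
  have hB := coboundaries_le_ker sq n
  refine exists_shortExact_of_surjective hq.surjective (evaluation_surjective hθ hB) δ_surjective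
    (fun g => ?_) (fun f hf => ?_) (exact_rangePrecomp_evaluation hθ hB)
  · rw [hq.apply_eq_zero_iff, δ_eq_zero_iff, rangePrecomp_mem_range_iff range_le]
  · obtain ⟨F, hF⟩ := (hq.apply_eq_zero_iff f).1 hf
    refine hθ.evaluation_eq_zero_iff.2 fun x hx => ?_
    rw [← hF]
    exact (congrArg F hx).trans F.map_zero

end Dual

end CochainSeq

/-! ### Swellings of finite families of closed sets -/

section Swelling

variable {Y L : Type*} [TopologicalSpace Y] [NormalSpace Y] [Finite L] {Z W : L → Set Y}

theorem exists_isOpen_superset_iInter_eq_empty (hZ : ∀ l, IsClosed (Z l)) (h : ⋂ l, Z l = ∅) :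
    ∃ O : L → Set Y, (∀ l, IsOpen (O l)) ∧ (∀ l, Z l ⊆ O l) ∧ ⋂ l, O l = ∅ := by
  obtain ⟨V, hV, hVc, hVZ⟩ := exists_iUnion_eq_closed_subset (u := fun l => (Z l)ᶜ)
    (fun l => (hZ l).isOpen_compl) (fun _ => Set.toFinite _)
    (by rw [← Set.compl_iInter, h, Set.compl_empty])
  exact ⟨fun l => (V l)ᶜ, fun l => (hVc l).isOpen_compl,
    fun l => Set.subset_compl_comm.1 (hVZ l), by rw [← Set.compl_iUnion, hV, Set.compl_univ]⟩

theorem exists_isOpen_superset_biInter_nonempty (hZ : ∀ l, IsClosed (Z l)) (J : Set L) :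
    ∃ O : L → Set Y, (∀ l, IsOpen (O l)) ∧ (∀ l, Z l ⊆ O l) ∧
      ((⋂ l ∈ J, O l).Nonempty → (⋂ l ∈ J, Z l).Nonempty) := by
  rcases (⋂ l ∈ J, Z l).eq_empty_or_nonempty with hJ | hJ
  · obtain ⟨O, hO, hZO, hOJ⟩ := exists_isOpen_superset_iInter_eq_empty (Z := fun l : J => Z l)
      (fun l => hZ l) (by rwa [← Set.biInter_eq_iInter J fun l _ => Z l])
    refine ⟨fun l => ⋂ h : l ∈ J, O ⟨l, h⟩, fun l => isOpen_iInter_of_finite fun h => hO ⟨l, h⟩,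
      fun l => Set.subset_iInter fun h => hZO ⟨l, h⟩, fun ⟨y, hy⟩ => ?_⟩
    have hyO : y ∈ ⋂ l, O l := Set.mem_iInter.2 fun l =>
      Set.mem_iInter.1 (Set.mem_iInter₂.1 hy l.1 l.2) l.2
    exact absurd (hOJ ▸ hyO) (Set.notMem_empty y)
  · exact ⟨fun _ => Set.univ, fun _ => isOpen_univ, fun _ => Set.subset_univ _, fun _ => hJ⟩

theorem exists_isOpen_swelling (hZ : ∀ l, IsClosed (Z l)) :
    ∃ O : L → Set Y, (∀ l, IsOpen (O l)) ∧ (∀ l, Z l ⊆ O l) ∧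
      ∀ J : Set L, (⋂ l ∈ J, O l).Nonempty → (⋂ l ∈ J, Z l).Nonempty := by
  choose O hO hZO hOJ using exists_isOpen_superset_biInter_nonempty hZ
  refine ⟨fun l => ⋂ J, O J l, fun l => isOpen_iInter_of_finite fun J => hO J l,
    fun l => Set.subset_iInter fun J => hZO J l, fun J hJ => hOJ J (hJ.mono ?_)⟩
  exact Set.iInter₂_mono fun l _ => Set.iInter_subset _ J

end Swelling

namespace NerveCochain

variable {Y L : Type*} [TopologicalSpace Y] [NormalSpace Y] [T1Space Y] [Finite L]
  {Z W : L → Set Y}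

theorem exists_isOpen_isSimplex_imp (p : Y) (hZ : ∀ l, IsClosed (Z l)) (hW : ∀ l, IsOpen (W l))
    (hZW : ∀ l, Z l ⊆ W l) :
    ∃ O : L → Set Y, (∀ l, IsOpen (O l)) ∧ (∀ l, Z l ⊆ O l) ∧ (∀ l, O l ⊆ W l) ∧
      ∀ {n : ℕ} (t : Fin (n + 1) → L), (IsSimplex O {p} t → IsSimplex Z {p} t) ∧
        (IsSimplex O Set.univ t → IsSimplex Z Set.univ t) := by
  obtain ⟨O, hO, hZO, hOJ⟩ := exists_isOpen_swelling hZ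
  let N (l : L) : Set Y := {y | y = p → p ∈ Z l}
  have N_eq (l : L) : N l = ⋂ _ : p ∉ Z l, {p}ᶜ := by
    ext y
    simp only [N, Set.mem_ofPred_eq, Set.mem_iInter, Set.mem_compl_singleton_iff]
    tauto
  have isOpen_N (l : L) : IsOpen (N l) :=
    N_eq l ▸ isOpen_iInter_of_finite fun _ => isOpen_compl_singleton
  refine ⟨fun l => O l ∩ W l ∩ N l, fun l => ((hO l).inter (hW l)).inter (isOpen_N l),
    fun l y hy => ⟨⟨hZO l hy, hZW l hy⟩, fun h => h ▸ hy⟩, fun l y hy => hy.1.2,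
    fun t => ⟨fun ht => ?_, fun ⟨y, _, hy⟩ => ?_⟩⟩
  · rw [isSimplex_singleton] at ht ⊢
    exact fun i => (ht i).2 rfl
  · obtain ⟨z, hz⟩ := hOJ (Set.range t)
      ⟨y, Set.mem_iInter₂.2 <| Set.forall_mem_range.2 fun i => (hy i).1.1⟩
    exact ⟨z, Set.mem_univ z, fun i => Set.mem_iInter₂.1 hz (t i) ⟨i, rfl⟩⟩

end NerveCochain

/-! ### The cohomology of the cochains on ultrafilters -/

theorem isSubquotient_mk' {M : Type*} [AddCommGroup M] (Z B : AddSubgroup M) :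
    IsSubquotient Z B (QuotientAddGroup.mk' (B.addSubgroupOf Z)) where
  surjective := QuotientAddGroup.mk'_surjective _
  apply_eq_zero_iff x :=
    (QuotientAddGroup.eq_zero_iff x).trans AddSubgroup.mem_addSubgroupOf

theorem finite_range_prodMk {α β γ : Type*} {f : α → β} {g : α → γ} (hf : (Set.range f).Finite)
    (hg : (Set.range g).Finite) : (Set.range fun x => (f x, g x)).Finite :=
  (hf.prod hg).subset (Set.range_subset_iff.2 fun x => ⟨⟨x, rfl⟩, ⟨x, rfl⟩⟩)

namespace UltraCochain

open TupleCochain NerveCochain Topology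

variable {Y : Type u} [TopologicalSpace Y] {n : ℕ} {p : Y}

section UltraPull

variable {L M : Type*} {ρ : Y → L} {τ : Y → M} {F : Point Y n → ℤ}

/-- The pullback of cochains under a labelling with finitely many values. -/
noncomputable def ultraPull (hρ : (Set.range ρ).Finite) : Cochain L n →+ (Point Y n → ℤ) where
  toFun a s := a (exists_label hρ s).choose
  map_zero' := rfl
  map_add' _ _ := rfl

theorem isPull_ultraPull (hρ : (Set.range ρ).Finite) (a : Cochain L n) :
    IsPull ρ a (ultraPull hρ a) := fun s _ ht =>
  congrArg a (funext fun i => eq_of_eventually_eq ((exists_label hρ s).choose_spec i) (ht i))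

theorem ultraPull_eq_zero_iff (hρ : (Set.range ρ).Finite) {a : Cochain L n} :
    ultraPull hρ a = 0 ↔ a ∈ vanishingOn (fibreClosure ρ) Set.univ n := by
  constructor
  · intro h t ht
    obtain ⟨s, hs⟩ := exists_point ht
    rw [← isPull_ultraPull hρ a s t hs, h, Pi.zero_apply]
  · exact fun h => funext fun s => h _ (isSimplex_of_eventually (exists_label hρ s).choose_spec)

theorem coboundary_ultraPull (hρ : (Set.range ρ).Finite) (a : Cochain L n) :
    coboundary (ultraPull hρ a) = ultraPull hρ (δ a) :=
  (isPull_ultraPull hρ a).coboundary.unique hρ (isPull_ultraPull hρ (δ a))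

theorem ultraPull_pull (hτ : (Set.range τ).Finite) (q : M → L) (hρ : (Set.range (q ∘ τ)).Finite)
    (a : Cochain L n) : ultraPull hτ (pull q a) = ultraPull hρ a :=
  (isPull_ultraPull hτ _).unique hτ (isPull_ultraPull hρ a).comp

theorem alt_mem_vanishingOn_fibreClosure {Z : L → Set Y} {A : Set Y}
    (hZ : ∀ l, fibreClosure ρ l ⊆ Z l) {c : Cochain L n} (hc : c ∈ vanishingOn Z A n) :
    alt c ∈ vanishingOn (fibreClosure ρ) A n :=
  fun s hs => alt_mem_vanishingOn hc s (hs.mono hZ)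

theorem ultraPull_mem [RegularSpace Y] (hρ : (Set.range ρ).Finite) {a : Cochain L n}
    (ha : IsAlt a) (har : a ∈ vanishingOn (fibreClosure ρ) {p} n) :
    ultraPull hρ a ∈ cochains n p := by
  have := hρ.to_subtype
  have h : IsPull (Subtype.val ∘ Set.rangeFactorization ρ) a (ultraPull hρ a) :=
    isPull_ultraPull hρ a
  exact mem_of_isPull (ha.pull Subtype.val)
    (pull_mem_vanishingOn har fun s hs => hs.comp (fibreClosure_comp_subset Subtype.val)) h.comp

theorem exists_ultraPull_eq (hF : F ∈ cochains n p) :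
    ∃ (L : Type) (_ : Finite L) (ρ : Y → L) (a : Cochain L n),
      IsAlt a ∧ a ∈ vanishingOn (fibreClosure ρ) {p} n ∧
        ultraPull (Set.toFinite (Set.range ρ)) a = F := by
  obtain ⟨L, _, ρ, a, ha, har, hF⟩ := exists_isPull hF
  exact ⟨L, ‹_›, ρ, a, ha, har, (isPull_ultraPull _ a).unique (Set.toFinite _) hF⟩

end UltraPull

variable [RegularSpace Y]

variable (p n) in
/-- The coboundary operator on the group of cochains. -/
def d : cochains n p →+ cochains (n + 1) p :=
  (coboundary.comp (cochains n p).subtype).codRestrict (cochains (n + 1) p)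
    fun F => coboundary_mem F.2

theorem d_d (F : cochains n p) : d (n + 1) p (d n p F) = 0 :=
  Subtype.ext (coboundary_coboundary F.1)

variable (n p) in
/-- The cohomology of the cochains on ultrafilters. -/
abbrev Cohomology : Type u :=
  (d n p).ker ⧸ (CochainSeq.coboundaries (fun n => d n p) n).addSubgroupOf (d n p).ker

section Coboundaries

variable {L M : Type*} {ρ : Y → L} {τ : Y → M} {a : Cochain L n} {F : cochains n p}

theorem mem_coboundaries_of_ultraPull_eq (hρ : (Set.range ρ).Finite) (hF : ultraPull hρ a = F.1)
    (halt : IsAlt a) (ha : a ∈ NerveCochain.coboundaries (fibreClosure ρ) {p} n) :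
    F ∈ CochainSeq.coboundaries (fun n => d n p) n := by
  cases n with
  | zero => exact Subtype.ext (hF.symm.trans ((ultraPull_eq_zero_iff hρ).2 ha))
  | succ n =>
    obtain ⟨b, hb, hbalt, hab⟩ := exists_isAlt_of_mem_coboundaries ha halt
    refine ⟨⟨ultraPull hρ b, ultraPull_mem hρ hbalt hb⟩, Subtype.ext ?_⟩
    refine (coboundary_ultraPull hρ b).trans (Eq.trans ?_ hF)
    rw [eq_comm, ← sub_eq_zero, ← map_sub]
    exact (ultraPull_eq_zero_iff hρ).2 hab

theorem exists_pull_mem_coboundaries (hρ : (Set.range ρ).Finite) (hF : ultraPull hρ a = F.1)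
    (h : F ∈ CochainSeq.coboundaries (fun n => d n p) n) :
    ∃ (M : Type) (_ : Finite M) (μ : Y → M), pull Prod.snd a ∈
      NerveCochain.coboundaries (fibreClosure fun y => (μ y, ρ y)) {p} n := by
  cases n with
  | zero =>
    have ha : a ∈ vanishingOn (fibreClosure ρ) Set.univ 0 :=
      (ultraPull_eq_zero_iff hρ).1 (hF.trans (congrArg Subtype.val h))
    exact ⟨Unit, inferInstance, fun _ => (),
      pull_mem_vanishingOn ha fun s hs => hs.comp (fibreClosure_comp_subset Prod.snd)⟩
  | succ n =>
    obtain ⟨B, rfl⟩ := h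
    obtain ⟨M, _, μ, b, -, hb, hbB⟩ := exists_ultraPull_eq B.2
    let τ : Y → M × L := fun y => (μ y, ρ y)
    have hτ : (Set.range τ).Finite := finite_range_prodMk (Set.toFinite (Set.range μ)) hρ
    refine ⟨M, ‹_›, μ, mem_coboundaries_succ.2 ⟨pull Prod.fst b,
      pull_mem_vanishingOn hb fun s hs => hs.comp (fibreClosure_comp_subset (τ := τ) Prod.fst),
      (ultraPull_eq_zero_iff hτ).1 ?_⟩⟩
    rw [map_sub, sub_eq_zero, ultraPull_pull hτ Prod.snd hρ, ← coboundary_ultraPull,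
      ultraPull_pull hτ Prod.fst (Set.toFinite (Set.range μ)), hbB, hF]
    rfl

end Coboundaries

section CocycleClass

variable {V W : Type*} {Z : V → Set Y} {ZW : W → Set Y} {ρ : Y → V} {τ : Y → W}

theorem ultraPull_alt_mem_ker (hρ : (Set.range ρ).Finite) (hZ : ∀ v, fibreClosure ρ v ⊆ Z v)
    {c : Cochain V n} (hc : c ∈ cocycles Z {p} n) :
    (⟨ultraPull hρ (alt c), ultraPull_mem hρ (isAlt_alt _)
      (alt_mem_vanishingOn_fibreClosure hZ hc.1)⟩ : cochains n p) ∈ (d n p).ker := by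
  refine AddMonoidHom.mem_ker.2 (Subtype.ext ?_)
  change coboundary (ultraPull hρ (alt c)) = 0
  rw [coboundary_ultraPull, ultraPull_eq_zero_iff, ← alt_δ]
  exact alt_mem_vanishingOn_fibreClosure hZ hc.2

/-- The cocycle on ultrafilters that a cocycle of the nerve of `Z` induces, by means of a
labelling whose fibres have closures in the members of `Z`. -/
noncomputable def ofCocycle (hρ : (Set.range ρ).Finite) (hZ : ∀ v, fibreClosure ρ v ⊆ Z v) :
    cocycles Z {p} n →+ (d n p).ker :=
  AddMonoidHom.mk'
    (fun c => ⟨⟨ultraPull hρ (alt c.1), ultraPull_mem hρ (isAlt_alt _)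
        (alt_mem_vanishingOn_fibreClosure hZ c.2.1)⟩, ultraPull_alt_mem_ker hρ hZ c.2⟩)
    fun c c' => Subtype.ext <| Subtype.ext <| by
      simp only [AddSubgroup.coe_add, map_add]

/-- The class of the cocycle on ultrafilters that a cocycle of a nerve induces. -/
noncomputable def cocycleClass (hρ : (Set.range ρ).Finite) (hZ : ∀ v, fibreClosure ρ v ⊆ Z v) :
    cocycles Z {p} n →+ Cohomology n p :=
  (QuotientAddGroup.mk' _).comp (ofCocycle hρ hZ)

theorem cocycleClass_eq_mk_iff (hρ : (Set.range ρ).Finite) (hZ : ∀ v, fibreClosure ρ v ⊆ Z v)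
    {c : cocycles Z {p} n} {F : (d n p).ker} :
    cocycleClass hρ hZ c = QuotientAddGroup.mk' _ F ↔
      (ofCocycle hρ hZ c).1 - F.1 ∈ CochainSeq.coboundaries (fun n => d n p) n := by
  rw [cocycleClass, AddMonoidHom.comp_apply, ← sub_eq_zero, ← map_sub]
  exact (isSubquotient_mk' _ _).apply_eq_zero_iff _

theorem cocycleClass_eq_zero (hρ : (Set.range ρ).Finite) (hZ : ∀ v, fibreClosure ρ v ⊆ Z v)
    {c : cocycles Z {p} n} (hc : c.1 ∈ NerveCochain.coboundaries Z {p} n) :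
    cocycleClass hρ hZ c = 0 := by
  refine ((isSubquotient_mk' _ _).apply_eq_zero_iff _).2
    (mem_coboundaries_of_ultraPull_eq hρ rfl (isAlt_alt c.1) ?_)
  have halt : alt c.1 ∈ NerveCochain.coboundaries Z {p} n := by
    rw [← sub_sub_cancel c.1 (alt c.1)]
    exact sub_mem hc (sub_alt_mem_coboundaries c.2)
  exact pull_mem_coboundaries_of_subset (φ := id) halt hZ

theorem cocycleClass_pull (hρ : (Set.range ρ).Finite) (hZ : ∀ v, fibreClosure ρ v ⊆ Z v)
    (hτ : (Set.range τ).Finite) (hZW : ∀ w, fibreClosure τ w ⊆ ZW w) {q : W → V}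
    (hq : ∀ w, ZW w ⊆ Z (q w)) (c : cocycles Z {p} n) :
    cocycleClass hρ hZ c = cocycleClass hτ hZW ⟨pull q c.1, pull_mem_cocycles c.2 hq⟩ := by
  let χ : Y → V × W := fun y => (ρ y, τ y)
  have hχ : (Set.range χ).Finite := finite_range_prodMk hρ hτ
  refine (cocycleClass_eq_mk_iff hρ hZ).2 (mem_coboundaries_of_ultraPull_eq hχ
    (a := pull Prod.fst (alt c.1) - pull Prod.snd (alt (pull q c.1))) ?_
    (((isAlt_alt _).pull _).sub ((isAlt_alt _).pull _))
    (pull_fst_alt_sub_pull_snd_alt_mem_coboundaries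
      (fun m => (fibreClosure_comp_subset Prod.fst m).trans (hZ m.1))
      (fun m => (fibreClosure_comp_subset Prod.snd m).trans (hZW m.2)) hq c.2))
  rw [map_sub, ultraPull_pull hχ Prod.fst hρ, ultraPull_pull hχ Prod.snd hτ]
  rfl

theorem exists_pull_mem_coboundaries_of_cocycleClass_eq_zero (hρ : (Set.range ρ).Finite)
    (hZ : ∀ v, fibreClosure ρ v ⊆ Z v) {c : cocycles Z {p} n} (hc : cocycleClass hρ hZ c = 0) :
    ∃ (M : Type) (_ : Finite M) (μ : Y → M), pull Prod.snd c.1 ∈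
      NerveCochain.coboundaries (fibreClosure fun y => (μ y, ρ y)) {p} n := by
  obtain ⟨M, _, μ, halt⟩ :=
    exists_pull_mem_coboundaries hρ rfl ((isSubquotient_mk' _ _).apply_eq_zero_iff _ |>.1 hc)
  refine ⟨M, ‹_›, μ, ?_⟩
  rw [← sub_add_cancel c.1 (alt c.1), map_add]
  exact add_mem (pull_mem_coboundaries_of_subset (sub_alt_mem_coboundaries c.2) fun m =>
    (fibreClosure_comp_subset (τ := fun y => (μ y, ρ y)) Prod.snd m).trans (hZ m.2)) halt

end CocycleClass

section OpenLabelling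

variable [NormalSpace Y] [T1Space Y]

theorem exists_cocycleClass_eq (x : Cohomology n p) :
    ∃ (L : Type) (_ : Finite L) (ρ : Y → L) (O : L → Set Y) (hO : ∀ l, fibreClosure ρ l ⊆ O l)
      (c : cocycles O {p} n), (∀ l, IsOpen (O l)) ∧
        cocycleClass (Set.toFinite (Set.range ρ)) hO c = x := by
  obtain ⟨F, rfl⟩ := QuotientAddGroup.mk'_surjective _ x
  obtain ⟨L, _, ρ, a, halt, ha, haF⟩ := exists_ultraPull_eq F.1.2
  obtain ⟨O, hO, hρO, -, hsimplex⟩ := exists_isOpen_isSimplex_imp p (W := fun _ => Set.univ)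
    (fun l => isClosed_closure (s := ρ ⁻¹' {l})) (fun _ => isOpen_univ) fun _ => Set.subset_univ _
  have δa : δ a ∈ vanishingOn (fibreClosure ρ) Set.univ (n + 1) := by
    rw [← ultraPull_eq_zero_iff (Set.toFinite _), ← coboundary_ultraPull, haF]
    exact congrArg Subtype.val F.2
  refine ⟨L, ‹_›, ρ, O, hρO, ⟨a, fun s hs => ha s ((hsimplex s).1 hs),
    fun s hs => δa s ((hsimplex s).2 hs)⟩, hO, congrArg _ (Subtype.ext (Subtype.ext ?_))⟩
  exact (congrArg _ halt.alt_eq).trans haF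

theorem exists_pull_mem_coboundaries_of_isOpen {V : Type w} {Z : V → Set Y} {ρ : Y → V}
    (hρ : (Set.range ρ).Finite) (hρZ : ∀ v, fibreClosure ρ v ⊆ Z v) (hZ : ∀ v, IsOpen (Z v))
    {c : cocycles Z {p} n} (hc : cocycleClass hρ hρZ c = 0) :
    ∃ (L : Type w) (τ : Y → L) (O : L → Set Y) (q : L → V),
      (∀ l, IsOpen (O l)) ∧ (∀ l, fibreClosure τ l ⊆ O l) ∧ (∀ l, O l ⊆ Z (q l)) ∧
        pull q c.1 ∈ NerveCochain.coboundaries O {p} n := by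
  obtain ⟨M, _, μ, hμ⟩ := exists_pull_mem_coboundaries_of_cocycleClass_eq_zero hρ hρZ hc
  let χ : Y → M × V := fun y => (μ y, ρ y)
  have := (finite_range_prodMk (Set.toFinite (Set.range μ)) hρ : (Set.range χ).Finite).to_subtype
  let τ : Y → Set.range χ := Set.rangeFactorization χ
  have hτχ (l : Set.range χ) : fibreClosure τ l ⊆ fibreClosure χ l.1 :=
    fibreClosure_comp_subset Subtype.val l
  obtain ⟨O, hO, hτO, hOZ, hsimplex⟩ := exists_isOpen_isSimplex_imp p
    (fun l => isClosed_closure (s := τ ⁻¹' {l})) (fun l => hZ l.1.2)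
    fun l => (hτχ l).trans ((fibreClosure_comp_subset (τ := χ) Prod.snd l.1).trans (hρZ l.1.2))
  refine ⟨Set.range χ, τ, O, fun l => l.1.2, hO, hτO, hOZ, ?_⟩
  exact pull_mem_coboundaries (φ := id) (pull_mem_coboundaries_of_subset hμ hτχ)
    (fun s => (hsimplex s).1) fun s => (hsimplex s).2

end OpenLabelling

end UltraCochain

/-! ### Čech cohomology -/

section Lift

variable {M H N : Type*} [AddCommGroup M] [AddCommGroup H] [AddCommGroup N] {Z B : AddSubgroup M}
  {θ : Z →+ H}

/-- The homomorphism on a subquotient induced by a homomorphism that vanishes on `B`. -/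
noncomputable def IsSubquotient.lift (h : IsSubquotient Z B θ) (φ : Z →+ N)
    (hφ : ∀ x : Z, x.1 ∈ B → φ x = 0) : H →+ N :=
  θ.liftOfRightInverse _ (Function.rightInverse_surjInv h.surjective)
    ⟨φ, fun x hx => hφ x ((h.apply_eq_zero_iff x).1 hx)⟩

theorem IsSubquotient.lift_apply (h : IsSubquotient Z B θ) {φ : Z →+ N}
    (hφ : ∀ x : Z, x.1 ∈ B → φ x = 0) (x : Z) : h.lift φ hφ (θ x) = φ x :=
  θ.liftOfRightInverse_comp_apply _ _ _ x

end Lift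

namespace Cech

open TupleCochain NerveCochain
open UltraCochain (Cohomology cocycleClass fibreClosure)

variable {Y : Type u} [TopologicalSpace Y] {n : ℕ}

section OpenCovers

/-- The cover by the members of an indexed family. -/
def OpenCover.ofFamily {L : Type*} (O : L → Set Y) (hO : ∀ l, IsOpen (O l))
    (hc : ∀ y, ∃ l, y ∈ O l) : OpenCover Y where
  sets := Set.range O
  isOpen := Set.forall_mem_range.2 hO
  covers := Set.eq_univ_of_forall fun y => (hc y).elim fun l hl => ⟨O l, ⟨l, rfl⟩, hl⟩

instance : Nonempty (OpenCover Y) :=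
  ⟨.ofFamily (fun _ : Unit => Set.univ) (fun _ => isOpen_univ) fun y => ⟨(), Set.mem_univ y⟩⟩

theorem OpenCover.exists_mem (α : OpenCover Y) (y : Y) : ∃ U : α.sets, y ∈ U.1 := by
  obtain ⟨U, hU, hy⟩ := Set.mem_sUnion.1 (α.covers ▸ Set.mem_univ y)
  exact ⟨⟨U, hU⟩, hy⟩

instance : IsDirectedOrder (OpenCover Y) where
  directed α β := by
    refine ⟨.ofFamily (fun q : α.sets × β.sets => q.1.1 ∩ q.2.1)
      (fun q => (α.isOpen _ q.1.2).inter (β.isOpen _ q.2.2)) (fun y => ?_),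
      Set.forall_mem_range.2 fun q => ⟨q.1.1, q.1.2, Set.inter_subset_left⟩,
      Set.forall_mem_range.2 fun q => ⟨q.2.1, q.2.2, Set.inter_subset_right⟩⟩
    obtain ⟨U, hU⟩ := α.exists_mem y
    obtain ⟨V, hV⟩ := β.exists_mem y
    exact ⟨(U, V), hU, hV⟩

theorem OpenCover.exists_partition [CompactSpace Y] [NormalSpace Y] (α : OpenCover Y) :
    ∃ π : Y → α.sets, (Set.range π).Finite ∧ ∀ U, fibreClosure π U ⊆ U.1 := by
  obtain ⟨t, ht⟩ := isCompact_univ.elim_finite_subcover (fun U : α.sets => U.1)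
    (fun U => α.isOpen U.1 U.2) fun y _ => Set.mem_iUnion.2 (α.exists_mem y)
  obtain ⟨v, hv, hvc, hvs⟩ := exists_iUnion_eq_closed_subset (u := fun U : t => U.1.1)
    (fun U => α.isOpen U.1.1 U.1.2) (fun _ => Set.toFinite _) (Set.univ_subset_iff.1 (by
      rwa [Set.iUnion_subtype (p := (· ∈ t)) (s := fun U => U.1.1)]))
  choose π hπ using fun y => Set.mem_iUnion.1 (hv.symm ▸ Set.mem_univ y : y ∈ ⋃ i, v i)
  refine ⟨Subtype.val ∘ π, ?_, fun U => ?_⟩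
  · exact t.finite_toSet.subset (Set.range_subset_iff.2 fun y => (π y).2)
  · by_cases hU : U ∈ t
    · refine (closure_minimal ?_ (hvc ⟨U, hU⟩)).trans (hvs ⟨U, hU⟩)
      rintro y rfl
      exact hπ y
    · have fibre_eq : Subtype.val ∘ π ⁻¹' {U} = ∅ :=
        Set.eq_empty_of_forall_notMem fun y hy => hU (hy ▸ (π y).2)
      rw [fibreClosure, fibre_eq, closure_empty]
      exact Set.empty_subset _

/-- A chosen finite partition of the space, indexed by members of an open cover that contain the
closures of the respective parts. -/
noncomputable def OpenCover.part [CompactSpace Y] [NormalSpace Y] (α : OpenCover Y) : Y → α.sets :=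
  α.exists_partition.choose

variable [CompactSpace Y] [NormalSpace Y] (α : OpenCover Y)

theorem OpenCover.finite_range_part : (Set.range α.part).Finite :=
  α.exists_partition.choose_spec.1

theorem OpenCover.fibreClosure_part_subset (U : α.sets) : fibreClosure α.part U ⊆ U.1 :=
  α.exists_partition.choose_spec.2 U

end OpenCovers

section Nerves

/-- The members of a cover, as a family indexed by themselves. -/
abbrev OpenCover.members (α : OpenCover Y) : α.sets → Set Y :=
  Subtype.val

variable {α β : OpenCover Y} {A : Set Y}

theorem isSimplex_members_iff {s : Fin (n + 1) → α.sets} :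
    IsSimplex α.members A s ↔ (inter s ∩ A).Nonempty := by
  simp only [IsSimplex, inter, Set.Nonempty, Set.mem_inter_iff, Set.mem_iInter, and_comm]

theorem isSimplex_members_univ_iff {s : Fin (n + 1) → α.sets} :
    IsSimplex α.members Set.univ s ↔ (inter s).Nonempty := by
  rw [isSimplex_members_iff, Set.inter_univ]

/-- The restriction of a cochain to the simplices of the nerve. -/
def restrict : vanishingOn α.members A n →+ cochains A α n where
  toFun c := ⟨fun s => c.1 s.1, fun s hs => c.2 s.1 (isSimplex_members_iff.2 hs)⟩
  map_zero' := rfl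
  map_add' _ _ := rfl

theorem restrict_surjective :
    Function.Surjective (restrict : vanishingOn α.members A n →+ cochains A α n) := by
  intro c
  have extend_apply (s : Simplex α n) : Function.extend Subtype.val c.1 0 s.1 = c.1 s :=
    Subtype.val_injective.extend_apply c.1 0 s
  refine ⟨⟨Function.extend Subtype.val c.1 0, fun s hs => ?_⟩, Subtype.ext (funext extend_apply)⟩
  have hsA := isSimplex_members_iff.1 hs
  exact (extend_apply ⟨s, hsA.mono Set.inter_subset_left⟩).trans (c.2 _ hsA)

theorem restrict_eq_zero_iff {c : vanishingOn α.members A n} :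
    restrict c = 0 ↔ c.1 ∈ vanishingOn α.members Set.univ n := by
  rw [Subtype.ext_iff, funext_iff, Subtype.forall]
  exact forall_congr' fun s => forall_prop_congr (fun _ => Iff.rfl) isSimplex_members_univ_iff.symm

theorem coboundary_restrict (c : vanishingOn α.members A n) :
    coboundary A α n (restrict c) = restrict ⟨δ c.1, δ_mem_vanishingOn c.2⟩ := rfl

theorem restrict_mem_ker_iff {c : vanishingOn α.members A n} :
    restrict c ∈ (coboundary A α n).ker ↔ c.1 ∈ cocycles α.members A n := by
  rw [AddMonoidHom.mem_ker, coboundary_restrict, restrict_eq_zero_iff]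
  exact (and_iff_right c.2).symm

theorem restrict_mem_coboundaries_iff {c : vanishingOn α.members A n} :
    restrict c ∈ CochainSeq.coboundaries (coboundary A α) n ↔
      c.1 ∈ NerveCochain.coboundaries α.members A n := by
  cases n with
  | zero => exact restrict_eq_zero_iff
  | succ n =>
    refine (Iff.trans ?_ mem_coboundaries_succ.symm)
    refine (restrict_surjective.exists (p := fun b => coboundary A α n b = restrict c)).trans ?_
    rw [Subtype.exists]
    refine exists_congr fun b => (exists_congr fun hb => ?_).trans exists_prop
    rw [coboundary_restrict, eq_comm, ← sub_eq_zero, ← map_sub, restrict_eq_zero_iff]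
    rfl

/-- The class of a cocycle in the cohomology of the nerve. -/
noncomputable def nerveClass (A : Set Y) (α : OpenCover Y) (n : ℕ) :
    cocycles α.members A n →+ (complex A α).homology n :=
  (CochainSeq.toHomology (coboundary A α) (coboundary_coboundary A α) n).comp
    ((restrict.comp (AddSubgroup.inclusion inf_le_left)).codRestrict _
      fun c => restrict_mem_ker_iff.2 c.2)

theorem isSubquotient_nerveClass : IsSubquotient (cocycles α.members A n)
    (NerveCochain.coboundaries α.members A n) (nerveClass A α n) where
  surjective x := by
    obtain ⟨y, rfl⟩ := (CochainSeq.isSubquotient_toHomology (coboundary A α)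
      (coboundary_coboundary A α) n).surjective x
    obtain ⟨c, hc⟩ := restrict_surjective y.1
    exact ⟨⟨c.1, restrict_mem_ker_iff.1 (hc ▸ y.2)⟩, congrArg
      (CochainSeq.toHomology (coboundary A α) (coboundary_coboundary A α) n) (Subtype.ext hc)⟩
  apply_eq_zero_iff c :=
    ((CochainSeq.isSubquotient_toHomology _ _ n).apply_eq_zero_iff _).trans
      restrict_mem_coboundaries_iff

theorem homologyMap_nerveClass (q : Projection α β) (c : cocycles α.members A n) :
    (HomologicalComplex.homologyMap (q.map A) n).hom (nerveClass A α n c) =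
      nerveClass A β n ⟨pull q.toFun c.1, pull_mem_cocycles c.2 q.subset⟩ :=
  CochainSeq.homologyMap_toHomology (coboundary A α) (coboundary_coboundary A α)
    (coboundary A β) (coboundary_coboundary A β) (q.map A)
    (x := ⟨restrict ⟨c.1, c.2.1⟩, restrict_mem_ker_iff.2 c.2⟩)
    (y := ⟨restrict ⟨pull q.toFun c.1, _⟩, restrict_mem_ker_iff.2 (pull_mem_cocycles c.2 q.subset)⟩)
    rfl

end Nerves

section Comparison

variable {p : Y}

open Classical in
/-- The map from the cohomology of the nerve of a cover to Čech cohomology. -/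
noncomputable def ofCover (A : Set Y) (n : ℕ) (α : OpenCover Y) :
    (complex A α).homology n →+ cohomology A n :=
  AddCommGroup.DirectLimit.of (fun α : OpenCover Y => ((complex A α).homology n : Type u))
    (fun _ _ h => (HomologicalComplex.homologyMap ((projection h).map A) n).hom) α

theorem exists_ofCover_eq {A : Set Y} (x : cohomology A n) :
    ∃ (α : OpenCover Y) (c : cocycles α.members A n), ofCover A n α (nerveClass A α n c) = x := by
  classical
  induction x using AddCommGroup.DirectLimit.induction_on with
  | ih α y =>
    obtain ⟨c, rfl⟩ := isSubquotient_nerveClass.surjective y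
    exact ⟨α, c, rfl⟩

theorem ofCover_nerveClass_eq_zero {A : Set Y} {α : OpenCover Y} {c : cocycles α.members A n}
    {L : Type*} {O : L → Set Y} (hO : ∀ l, IsOpen (O l)) (hcover : ∀ y, ∃ l, y ∈ O l)
    {q : L → α.sets} (hq : ∀ l, O l ⊆ (q l).1)
    (hc : pull q c.1 ∈ NerveCochain.coboundaries O A n) :
    ofCover A n α (nerveClass A α n c) = 0 := by
  let β : OpenCover Y := .ofFamily O hO hcover
  choose index hindex using fun V : β.sets => V.2
  have subset_index (V : β.sets) : V.1 ⊆ O (index V) := (hindex V).ge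
  have hαβ : α ≤ β := Set.forall_mem_range.2 fun l => ⟨_, (q l).2, hq l⟩
  have pull_mem : pull (projection hαβ).toFun c.1 ∈ NerveCochain.coboundaries β.members A n := by
    rw [← sub_add_cancel (pull _ c.1) (pull index (pull q c.1))]
    exact add_mem (pull_sub_pull_mem_coboundaries (projection hαβ).subset
      (fun V => (subset_index V).trans (hq _)) c.2)
      (pull_mem_coboundaries_of_subset hc subset_index)
  have nerveClass_eq := (isSubquotient_nerveClass.apply_eq_zero_iff
    ⟨_, pull_mem_cocycles c.2 (projection hαβ).subset⟩).2 pull_mem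
  rw [← homologyMap_nerveClass] at nerveClass_eq
  classical
  refine (AddCommGroup.DirectLimit.of_f hαβ _).symm.trans ?_
  rw [nerveClass_eq, map_zero]

variable [CompactSpace Y] [T2Space Y]

/-- The map from the cohomology of the nerve of a cover to the cohomology of the cochains on
ultrafilters. -/
noncomputable def coverComparison (n : ℕ) (p : Y) (α : OpenCover Y) :
    (complex {p} α).homology n →+ Cohomology n p :=
  isSubquotient_nerveClass.lift (cocycleClass α.finite_range_part α.fibreClosure_part_subset)
    fun _ => UltraCochain.cocycleClass_eq_zero _ _

theorem coverComparison_nerveClass (α : OpenCover Y) (c : cocycles α.members {p} n) :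
    coverComparison n p α (nerveClass {p} α n c) =
      cocycleClass α.finite_range_part α.fibreClosure_part_subset c :=
  isSubquotient_nerveClass.lift_apply _ c

open Classical in
/-- The map from Čech cohomology to the cohomology of the cochains on ultrafilters. -/
noncomputable def comparison (n : ℕ) (p : Y) : cohomology {p} n →+ Cohomology n p :=
  AddCommGroup.DirectLimit.lift _ _ _ (coverComparison n p) fun α β h x => by
    obtain ⟨c, rfl⟩ := isSubquotient_nerveClass.surjective x
    rw [homologyMap_nerveClass, coverComparison_nerveClass, coverComparison_nerveClass]
    exact (UltraCochain.cocycleClass_pull _ _ _ _ (projection h).subset c).symm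

theorem comparison_ofCover (α : OpenCover Y) (c : cocycles α.members {p} n) :
    comparison n p (ofCover {p} n α (nerveClass {p} α n c)) =
      cocycleClass α.finite_range_part α.fibreClosure_part_subset c := by
  classical
  exact (AddCommGroup.DirectLimit.lift_of _ _ _ _ _).trans (coverComparison_nerveClass α c)

theorem comparison_injective : Function.Injective (comparison n p) := by
  refine (injective_iff_map_eq_zero _).2 fun x hx => ?_
  obtain ⟨α, c, rfl⟩ := exists_ofCover_eq x
  rw [comparison_ofCover] at hx
  obtain ⟨L, τ, O, q, hO, hτO, hq, hc⟩ := UltraCochain.exists_pull_mem_coboundaries_of_isOpen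
    _ _ (fun U : α.sets => α.isOpen U.1 U.2) hx
  exact ofCover_nerveClass_eq_zero hO (fun y => ⟨τ y, hτO _ (subset_closure rfl)⟩) hq hc

theorem comparison_surjective : Function.Surjective (comparison n p) := by
  intro x
  obtain ⟨L, _, ρ, O, hρO, c, hO, rfl⟩ := UltraCochain.exists_cocycleClass_eq x
  let α : OpenCover Y := .ofFamily O hO fun y => ⟨ρ y, hρO _ (subset_closure rfl)⟩
  choose index hindex using fun U : α.sets => U.2
  refine ⟨_, (comparison_ofCover α _).trans
    (UltraCochain.cocycleClass_pull _ _ _ _ (q := index) (fun U => (hindex U).ge) c).symm⟩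

theorem exists_isSubquotient_cohomology (n : ℕ) (p : Y) :
    ∃ θ : (UltraCochain.d n p).ker →+ cohomology {p} n,
      IsSubquotient _ (CochainSeq.coboundaries (fun n => UltraCochain.d n p) n) θ :=
  ⟨_, (isSubquotient_mk' _ _).trans_equiv (AddEquiv.ofBijective (comparison n p)
    ⟨comparison_injective, comparison_surjective⟩).symm⟩

end Comparison

end Cech

/-! ### Comparison with the one-point compactification -/

namespace Kolmogoroff

open UltraCochain (SetAway generator)
open OnePoint (infty)

variable {X : Type u} [TopologicalSpace X]

theorem closure_image_coe (E : Bounded X) :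
    closure ((↑) '' E.1 : Set (OnePoint X)) = (↑) '' closure E.1 :=
  (closure_minimal (Set.image_mono subset_closure)
    (OnePoint.isClosed_image_coe.2 ⟨isClosed_closure, E.2⟩)).antisymm
    (image_closure_subset_closure_image OnePoint.continuous_coe)

theorem isCompact_closure_preimage_coe (E : SetAway (infty : OnePoint X)) :
    IsCompact (closure ((↑) ⁻¹' E.1 : Set X)) := by
  have isClosed_and_isCompact := (OnePoint.isClosed_iff_of_notMem E.2).1 isClosed_closure
  exact isClosed_and_isCompact.2.of_isClosed_subset isClosed_closure
    (closure_minimal (Set.preimage_mono subset_closure) isClosed_and_isCompact.1)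

/-- The bounded subsets of `X` as the subsets of the one-point compactification whose closure does
not contain the point at infinity. -/
def Bounded.equivSetAway : Bounded X ≃ SetAway (infty : OnePoint X) where
  toFun E := ⟨(↑) '' E.1, by rw [closure_image_coe]; exact OnePoint.infty_notMem_image_coe⟩
  invFun E := ⟨(↑) ⁻¹' E.1, isCompact_closure_preimage_coe E⟩
  left_inv E := Subtype.ext (Set.preimage_image_eq _ OnePoint.coe_injective)
  right_inv E := Subtype.ext (Set.image_preimage_eq_of_subset fun _ hy =>
    OnePoint.ne_infty_iff_exists.1 fun h => E.2 (subset_closure (h ▸ hy)))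

theorem Bounded.closure_equivSetAway (E : Bounded X) :
    closure (equivSetAway E).1 = (↑) '' closure E.1 := closure_image_coe E

theorem Bounded.iInter_closure_equivSetAway {ι : Type*} [Nonempty ι] (E : ι → Bounded X) :
    ⋂ i, closure (equivSetAway (E i)).1 = (↑) '' ⋂ i, closure (E i).1 := by
  rw [OnePoint.coe_injective.injOn.image_iInter_eq]
  exact Set.iInter_congr fun i => closure_equivSetAway (E i)

variable {G : Type v} [AddCommGroup G] {n : ℕ}

theorem isChain_comp_equivSetAway {f : (Fin (n + 1) → SetAway (infty : OnePoint X)) → G}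
    (hf : UltraCochain.IsChain f) : IsChain X G n fun E => f (Bounded.equivSetAway ∘ E) where
  additive E i A B hAB := by
    simp only [Function.comp_update]
    exact hf.additive _ i _ _ _ (Set.disjoint_image_of_injective OnePoint.coe_injective hAB)
      (Set.image_union _ _ _)
  perm E σ := hf.perm (Bounded.equivSetAway ∘ E) σ
  eq_zero_of_eq E i j hij h := hf.eq_zero_of_eq _ i j hij (congrArg Bounded.equivSetAway h)
  eq_zero_of_closures E h := hf.eq_zero_of_closures _
    ((Bounded.iInter_closure_equivSetAway E).trans (h ▸ Set.image_empty _))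

theorem IsChain.comp_equivSetAway_symm {f : (Fin (n + 1) → Bounded X) → G}
    (hf : IsChain X G n f) : UltraCochain.IsChain fun E : Fin (n + 1) → SetAway infty =>
      f (Bounded.equivSetAway.symm ∘ E) where
  additive E i A B C hAB hC := by
    simp only [Function.comp_update]
    rw [← hf.additive _ i _ _ (hAB.preimage OnePoint.some)]
    congr 2
    exact Subtype.ext (congrArg (Set.preimage OnePoint.some) hC)
  perm E σ := hf.perm (Bounded.equivSetAway.symm ∘ E) σ
  eq_zero_of_eq E i j hij h := hf.eq_zero_of_eq _ i j hij (congrArg Bounded.equivSetAway.symm h)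
  eq_zero_of_closures E h := hf.eq_zero_of_closures _ <| by
    have key := Bounded.iInter_closure_equivSetAway (Bounded.equivSetAway.symm ∘ E)
    simp only [Function.comp_apply, Equiv.apply_symm_apply, h] at key
    exact Set.image_eq_empty.1 key.symm

variable (X G n) in
/-- The Kolmogoroff chain given by a homomorphism on the cochains on ultrafilters. -/
noncomputable def ofHom :
    (UltraCochain.cochains n (infty : OnePoint X) →+ G) →+ chains X G n where
  toFun φ := ⟨_, isChain_comp_equivSetAway (UltraCochain.isChain_of_hom φ)⟩
  map_zero' := rfl
  map_add' _ _ := rfl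

theorem ofHom_injective : Function.Injective (ofHom X G n) := by
  refine fun φ ψ h => UltraCochain.hom_ext fun E => ?_
  obtain ⟨E, rfl⟩ := Bounded.equivSetAway.surjective.comp_left E
  exact congrFun (congrArg Subtype.val h) E

theorem ofHom_surjective : Function.Surjective (ofHom X G n) := by
  intro f
  obtain ⟨φ, hφ⟩ := (show IsChain X G n f.1 from f.2).comp_equivSetAway_symm.exists_hom
  refine ⟨φ, Subtype.ext (funext fun E => (hφ _).trans (congrArg f.1 ?_))⟩
  exact funext fun i => Bounded.equivSetAway.symm_apply_apply (E i)

variable (X G n) in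
/-- The Kolmogoroff chains as the homomorphisms on the cochains on ultrafilters. -/
noncomputable def homEquiv :
    (UltraCochain.cochains n (infty : OnePoint X) →+ G) ≃+ chains X G n :=
  .ofBijective (ofHom X G n) ⟨ofHom_injective, ofHom_surjective⟩

variable [LocallyCompactSpace X] [T2Space X]

theorem boundary_homEquiv (φ : UltraCochain.cochains (n + 1) (infty : OnePoint X) →+ G) :
    boundary X G n (homEquiv X G (n + 1) φ) =
      homEquiv X G n (φ.comp (UltraCochain.d n infty)) := by
  refine Subtype.ext (funext fun E => ?_)
  obtain ⟨U, hU⟩ := exists_isHull E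
  have isChain_φ : IsChain X G (n + 1) (ofHom X G (n + 1) φ).1 := (ofHom X G (n + 1) φ).2
  refine (isChain_φ.boundaryFun_eq E U hU).trans (congrArg φ (Subtype.ext ?_))
  have closure_subset (i : Fin (n + 1)) :
      closure (Bounded.equivSetAway (E i)).1 ⊆ (Bounded.equivSetAway U).1 := by
    rw [Bounded.closure_equivSetAway]
    exact Set.image_mono (hU.2 i)
  refine Eq.trans ?_ (UltraCochain.coboundary_detFun _ (OnePoint.isOpen_image_coe.2 hU.1)
    closure_subset).symm
  exact congrArg UltraCochain.detFun (funext fun i => Fin.cases rfl (fun _ => rfl) i)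

theorem complex_d_homEquiv (n : ℕ)
    (φ : UltraCochain.cochains (n + 1) (infty : OnePoint X) →+ G) :
    ((complex X G).d (n + 1) n).hom (homEquiv X G (n + 1) φ) =
      homEquiv X G n (φ.comp (UltraCochain.d n infty)) := by
  have d_eq : (complex X G).d (n + 1) n = AddCommGrpCat.ofHom (boundary X G n) :=
    ChainComplex.of_d (fun n => AddCommGrpCat.of (chains X G n))
      (fun n => AddCommGrpCat.ofHom (boundary X G n)) n
  rw [d_eq]
  exact boundary_homEquiv φ

end Kolmogoroff

theorem theorem5_general {X : Type u} [TopologicalSpace X] [LocallyCompactSpace X] [T2Space X]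
    {G : Type v} [AddCommGroup G] (n : ℕ) :
    ∃ (i : ExtAb (Cech.cohomology {(OnePoint.infty : OnePoint X)} (n + 1)) G →+
          Kolmogoroff.homology X G n)
      (p : Kolmogoroff.homology X G n →+
          (Cech.cohomology {(OnePoint.infty : OnePoint X)} n →+ G)),
      Function.Injective i ∧ Function.Exact i p ∧ Function.Surjective p := by
  obtain ⟨θ, hθ⟩ := Cech.exists_isSubquotient_cohomology n (OnePoint.infty : OnePoint X)
  obtain ⟨θ', hθ'⟩ := Cech.exists_isSubquotient_cohomology (n + 1) (OnePoint.infty : OnePoint X)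
  exact CochainSeq.exists_universalCoefficients (fun n => Kolmogoroff.homEquiv X G n)
    Kolmogoroff.complex_d_homEquiv (fun n => UltraCochain.d_d) n hθ hθ'

theorem theorem5 {X : Type u} [TopologicalSpace X] [LocallyCompactSpace X] [ParacompactSpace X]
    [T2Space X] {G : Type v} [AddCommGroup G] (n : ℕ) :
    ∃ (i : ExtAb (Cech.cohomology {(OnePoint.infty : OnePoint X)} (n + 1)) G →+
          Kolmogoroff.homology X G n)
      (p : Kolmogoroff.homology X G n →+
          (Cech.cohomology {(OnePoint.infty : OnePoint X)} n →+ G)),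
      Function.Injective i ∧ Function.Exact i p ∧ Function.Surjective p :=
  theorem5_general n
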